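/- Let $M$ be an $n$-dimensional smooth manifold and $\varphi:M\to\mathbb S^{n+1}(1)\subset\mathbb E^{n+2}$ a smooth immersion making $M$ an orientable hypersurface with smooth unit normal field $N$ in the sphere. Let $g$ be the induced metric on $M$, let $H$ be the second fundamental tensor field, $H(X,Y)=g(BX,Y)$, where the shape operator $B$ is given by $\overline\nabla_XN=-BX$ with $\overline\nabla$ the Levi-Civita connection of the sphere, and let $H^2(X,Y)=g(B^2X,Y)$; traces are taken with respect to $g$. Let $V$ be a smooth torse-forming vector field on $\mathbb E^{n+2}$, i.e. $D_XV=aX+\psi(X)V$ with $D$ the flat connection, $a$ a smooth function and $\psi$ a smooth $1$-form. Let $N_{\mathbb S}$ be the outward unit normal of the sphere (so $N_{\mathbb S}(p)=p$), $\delta=\langle V,N\rangle|_M$, $\varrho=\langle V,N_{\mathbb S}\rangle|_M$, let $\xi$ be the tangential component of $V$ to the sphere and $U$ the tangential component of $\xi$ on $M$, so that $V|_M=U+\delta N+\varrho N_{\mathbb S}$. Let $\eta$ be a smooth $1$-form and $\lambda,\mu$ smooth functions on $M$; $a$ and $\psi$ are restricted to $M$ by means of $\varphi$. Then: i) $(U,\lambda,\mu)$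 is an almost $\eta$-Ricci soliton on $(M,g)$, i.e. $\frac12\pounds_Ug+\mathrm{Ric}=\lambda g+\mu\,\eta\otimes\eta$, if and only if for all $X,Y$ tangent to $M$ $$H^2(X,Y)=[\operatorname{tr}(H)+\delta]H(X,Y)+(n-1-\varrho-\lambda+a)g(X,Y)-\mu\,\eta(X)\eta(Y)+\tfrac12[\psi(X)g(U,Y)+\psi(Y)g(U,X)].$$ ii) $(U,\lambda,\mu)$ is an almost $\eta$-Yamabe soliton on $(M,g)$, i.e. $\frac12\pounds_Ug=(\mathrm{scal}-\lambda)g+\mu\,\eta\otimes\eta$, if and only if for all $X,Y$ tangent to $M$ $$\delta H(X,Y)=[n(n-1)+(\operatorname{tr}(H))^2-\operatorname{tr}(H^2)+\varrho-\lambda-a]g(X,Y)+\mu\,\eta(X)\eta(Y)-\tfrac12[\psi(X)g(U,Y)+\psi(Y)g(U,X)].$$ In this case, $M$ is a pseudo quasi-umbilical hypersurface, i.e. there are smooth functions $\alpha,\beta$, a smooth $1$-form $\varpi$ and a smooth symmetric $(0,2)$-tensor field $E$ with vanishing $g$-trace on $M$ such that $H=\alpha g+\beta\,\varpi\otimes\varpi+E$.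 -/

import Mathlib

open scoped Manifold ContDiff InnerProductSpace

namespace SphereSoliton

noncomputable section

/-- The Euclidean space `𝔼ⁿ`. -/
abbrev Euc (n : ℕ) := EuclideanSpace ℝ (Fin n)

/-- The unit sphere `𝕊ⁿ⁺¹(1)` in `𝔼ⁿ⁺²`. -/
abbrev USphere (n : ℕ) := Metric.sphere (0 : Euc (n + 1 + 1)) 1

section Tensors

variable {n : ℕ} {M : Type*} [TopologicalSpace M] [ChartedSpace (Euc n) M]

variable (n M) in
/-- Vector fields on `M` (no regularity). -/
abbrev VField := (x : M) → TangentSpace (𝓡 n) x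

variable (n M) in
/-- `1`-forms on `M` (no regularity). -/
abbrev Form1 := (x : M) → (TangentSpace (𝓡 n) x →L[ℝ] ℝ)

variable (n M) in
/-- Fields of continuous bilinear forms, i.e. `(0,2)`-tensor fields on `M` (no regularity). -/
abbrev Form2 := (x : M) → (TangentSpace (𝓡 n) x →L[ℝ] TangentSpace (𝓡 n) x →L[ℝ] ℝ)

variable (n M) in
/-- `(0,2)`-tensor fields as plain functions of a point and two tangent vectors. -/
abbrev Tensor2 := (x : M) → TangentSpace (𝓡 n) x → TangentSpace (𝓡 n) x → ℝ

/-- Smooth real functions on `M`. -/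
def SmoothFun (f : M → ℝ) : Prop := ContMDiff (𝓡 n) 𝓘(ℝ, ℝ) ∞ f

variable [IsManifold (𝓡 n) ∞ M]

/-- Smooth vector fields: smooth sections of the tangent bundle. -/
def SmoothVField (U : VField n M) : Prop :=
  ContMDiff (𝓡 n) (𝓡 n).tangent ∞ (fun x => (⟨x, U x⟩ : TangentBundle (𝓡 n) M))

/-- Smooth `1`-forms: smooth sections of the cotangent bundle. -/
def SmoothForm1 (η : Form1 n M) : Prop :=
  ContMDiff (𝓡 n) ((𝓡 n).prod 𝓘(ℝ, Euc n →L[ℝ] ℝ)) ∞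
    (fun x => Bundle.TotalSpace.mk' (Euc n →L[ℝ] ℝ)
      (E := fun x : M => TangentSpace (𝓡 n) x →L[ℝ] ℝ) x (η x))

/-- Smooth `(0,2)`-tensor fields: smooth sections of the bundle of bilinear forms. -/
def SmoothForm2 (T : Form2 n M) : Prop :=
  ContMDiff (𝓡 n) ((𝓡 n).prod 𝓘(ℝ, Euc n →L[ℝ] Euc n →L[ℝ] ℝ)) ∞
    (fun x => Bundle.TotalSpace.mk' (Euc n →L[ℝ] Euc n →L[ℝ] ℝ)
      (E := fun x : M => TangentSpace (𝓡 n) x →L[ℝ] TangentSpace (𝓡 n) x →L[ℝ] ℝ) x (T x))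

end Tensors

section Pointwise

/-! Linear algebra in one tangent space. By definition `T_x M = ℝⁿ`, the identification being the
one given by the preferred chart at `x`; `frame x` is the standard basis, that is, the coordinate
basis `∂₁, …, ∂ₙ` at `x` of that chart. -/

variable {n : ℕ} {M : Type*} [TopologicalSpace M] [ChartedSpace (Euc n) M]

/-- The coordinate basis of `T_x M` in the preferred chart at `x`. -/
def frame (x : M) (i : Fin n) : TangentSpace (𝓡 n) x :=
  (EuclideanSpace.single i (1 : ℝ) : Euc n)

/-- The components of a tangent vector at `x` in the basis `frame x`. -/
def comp {x : M} (v : TangentSpace (𝓡 n) x) (i : Fin n) : ℝ :=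
  let w : Euc n := v
  w i

/-- The components `T_{ij}` of a tensor at `x` in the basis `frame x`. -/
def gram (T : Tensor2 n M) (x : M) : Matrix (Fin n) (Fin n) ℝ :=
  Matrix.of fun i j => T x (frame x i) (frame x j)

/-- The trace `tr(T) = ∑ g^{ij} T_{ij}` of a `(0,2)`-tensor with respect to `g`. -/
def trace (g T : Tensor2 n M) (x : M) : ℝ :=
  ∑ i, ∑ j, (gram g x)⁻¹ i j * gram T x i j

/-- The square `T²(v, w) = ∑ g^{kl} T(v, ∂_k) T(∂_l, w)`. If `g(B v, w) = T(v, w)` with `B`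
self-adjoint, this is `g(B² v, w)`. -/
def square (g T : Tensor2 n M) : Tensor2 n M := fun x v w =>
  ∑ k, ∑ l, (gram g x)⁻¹ k l * T x v (frame x k) * T x (frame x l) w

/-- The vector `g`-dual to a linear form `α` on `T_x M`: `g(sharp α, w) = α(w)` for all `w`. -/
def sharp (g : Tensor2 n M) (x : M) (α : TangentSpace (𝓡 n) x → ℝ) : TangentSpace (𝓡 n) x :=
  ∑ i, (∑ j, (gram g x)⁻¹ i j * α (frame x j)) • frame x i

/-- The value on `(v, w)` of the bilinear form on `T_x M` with components `A i j`. -/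
def ofComponents {x : M} (A : Fin n → Fin n → ℝ) (v w : TangentSpace (𝓡 n) x) : ℝ :=
  ∑ i, ∑ j, A i j * comp v i * comp w j

end Pointwise

section Curvature

/-! Levi-Civita connection, curvature and Lie derivative in local coordinates. A point `p : Euc n`
stands for the point of `M` with coordinates `p` in the preferred chart at `x₀`. The tensors are
evaluated at `x` in the preferred chart at `x`. -/

variable {n : ℕ} {M : Type*} [TopologicalSpace M] [ChartedSpace (Euc n) M]

/-- The partial derivative `∂_i f`. -/
def pd (i : Fin n) (f : Euc n → ℝ) (p : Euc n) : ℝ :=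
  fderiv ℝ f p (EuclideanSpace.single i (1 : ℝ))

/-- The coordinate vector field `∂_i` of the chart at `x₀`. -/
def coordVec (x₀ : M) (p : Euc n) (i : Fin n) :
    TangentSpace (𝓡 n) ((extChartAt (𝓡 n) x₀).symm p) :=
  mfderiv 𝓘(ℝ, Euc n) (𝓡 n) (extChartAt (𝓡 n) x₀).symm p
    (EuclideanSpace.single i (1 : ℝ) : Euc n)

/-- The components `g_{ij}` in the chart at `x₀`, as functions of the coordinates. -/
def chartMetric (g : Tensor2 n M) (x₀ : M) (p : Euc n) : Matrix (Fin n) (Fin n) ℝ :=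
  Matrix.of fun i j =>
    g ((extChartAt (𝓡 n) x₀).symm p) (coordVec x₀ p i) (coordVec x₀ p j)

/-- The components `U^k` of a vector field in the chart at `x₀`. -/
def chartField (U : VField n M) (x₀ : M) (p : Euc n) : Euc n :=
  mfderiv (𝓡 n) 𝓘(ℝ, Euc n) (extChartAt (𝓡 n) x₀) ((extChartAt (𝓡 n) x₀).symm p)
    (U ((extChartAt (𝓡 n) x₀).symm p))

/-- The Christoffel symbols `Γ^k_{ij} = ½ g^{kl} (∂_i g_{jl} + ∂_j g_{il} - ∂_l g_{ij})` of a
metric `G` on a domain of `ℝⁿ`: `∇_{∂_i} ∂_j = Γ^k_{ij} ∂_k` for its Levi-Civita connection. -/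
def christoffel (G : Euc n → Matrix (Fin n) (Fin n) ℝ) (k i j : Fin n) (p : Euc n) : ℝ :=
  1 / 2 * ∑ l, (G p)⁻¹ k l *
    (pd i (fun q => G q j l) p + pd j (fun q => G q i l) p - pd l (fun q => G q i j) p)

/-- The curvature components `R^l_{ijk}`: `R(∂_i, ∂_j) ∂_k = R^l_{ijk} ∂_l`, where
`R(X, Y) Z = ∇_X ∇_Y Z - ∇_Y ∇_X Z - ∇_{[X, Y]} Z`. -/
def riemann (G : Euc n → Matrix (Fin n) (Fin n) ℝ) (l i j k : Fin n) (p : Euc n) : ℝ :=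
  pd i (christoffel G l j k) p - pd j (christoffel G l i k) p
    + ∑ m, (christoffel G l i m p * christoffel G m j k p
        - christoffel G l j m p * christoffel G m i k p)

/-- The Ricci tensor field `Ric(Y, Z) = tr (X ↦ R(X, Y) Z)` of the metric `g`. -/
def Ric (g : Tensor2 n M) : Tensor2 n M := fun x =>
  ofComponents fun j k => ∑ i, riemann (chartMetric g x) i i j k (extChartAt (𝓡 n) x x)

/-- The scalar curvature of the metric `g`. -/
def scal (g : Tensor2 n M) (x : M) : ℝ := trace g (Ric g) x

/-- The Lie derivative `£_U g`, with components
`U^k ∂_k g_{ij} + g_{kj} ∂_i U^k + g_{ik} ∂_j U^k`. -/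
def lieDeriv (U : VField n M) (g : Tensor2 n M) : Tensor2 n M := fun x =>
  ofComponents fun i j => ∑ k,
    (chartField U x (extChartAt (𝓡 n) x x) k
        * pd k (fun q => chartMetric g x q i j) (extChartAt (𝓡 n) x x)
      + chartMetric g x (extChartAt (𝓡 n) x x) k j
        * pd i (fun q => chartField U x q k) (extChartAt (𝓡 n) x x)
      + chartMetric g x (extChartAt (𝓡 n) x x) i k
        * pd j (fun q => chartField U x q k) (extChartAt (𝓡 n) x x))

end Curvature

section Solitons

variable {n : ℕ} {M : Type*} [TopologicalSpace M] [ChartedSpace (Euc n) M]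
  [IsManifold (𝓡 n) ∞ M]

/-- `(U, lam, mu)` is an almost `η`-Ricci soliton on the Riemannian manifold `(M, g)`:
`½ £_U g + Ric = lam g + mu η ⊗ η`. -/
structure IsAlmostEtaRicciSoliton (g : Tensor2 n M) (η : Form1 n M) (U : VField n M)
    (lam mu : M → ℝ) : Prop where
  smooth_field : SmoothVField U
  smooth_form : SmoothForm1 η
  smooth_lam : SmoothFun (n := n) lam
  smooth_mu : SmoothFun (n := n) mu
  equation : ∀ (x : M) (X Y : TangentSpace (𝓡 n) x),
    1 / 2 * lieDeriv U g x X Y + Ric g x X Y = lam x * g x X Y + mu x * (η x X * η x Y)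

/-- `(U, lam, mu)` is an almost `η`-Yamabe soliton on the Riemannian manifold `(M, g)`:
`½ £_U g = (scal - lam) g + mu η ⊗ η`. -/
structure IsAlmostEtaYamabeSoliton (g : Tensor2 n M) (η : Form1 n M) (U : VField n M)
    (lam mu : M → ℝ) : Prop where
  smooth_field : SmoothVField U
  smooth_form : SmoothForm1 η
  smooth_lam : SmoothFun (n := n) lam
  smooth_mu : SmoothFun (n := n) mu
  equation : ∀ (x : M) (X Y : TangentSpace (𝓡 n) x),
    1 / 2 * lieDeriv U g x X Y = (scal g x - lam x) * g x X Y + mu x * (η x X * η x Y)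

/-- A hypersurface with induced metric `g` and second fundamental tensor field `H` is pseudo
quasi-umbilical: `H = α g + β ϖ ⊗ ϖ + E` with smooth functions `α`, `β`, a `1`-form `ϖ` and a
symmetric trace-free `(0,2)`-tensor field `E`. -/
def IsPseudoQuasiUmbilical (g H : Tensor2 n M) : Prop :=
  ∃ (α β : M → ℝ) (ϖ : Form1 n M) (E : Form2 n M),
    SmoothFun (n := n) α ∧ SmoothFun (n := n) β ∧ SmoothForm1 ϖ ∧ SmoothForm2 E ∧
    (∀ (x : M) (X Y : TangentSpace (𝓡 n) x), E x X Y = E x Y X) ∧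
    (∀ x : M, trace g (fun y X Y => E y X Y) x = 0) ∧
    ∀ (x : M) (X Y : TangentSpace (𝓡 n) x),
      H x X Y = α x * g x X Y + β x * (ϖ x X * ϖ x Y) + E x X Y

end Solitons

/-- A smooth vector field `V` on `𝔼ᵐ` is torse-forming with smooth function `a` and smooth
`1`-form `ψ`: `D_X V = a X + ψ(X) V`, where `D` is the flat connection. -/
structure IsTorseForming {m : ℕ} (V : Euc m → Euc m) (a : Euc m → ℝ) (ψ : Euc m → (Euc m →L[ℝ] ℝ)) :
    Prop where
  smooth_field : ContDiff ℝ ∞ V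
  smooth_fun : ContDiff ℝ ∞ a
  smooth_form : ContDiff ℝ ∞ ψ
  equation : ∀ p X : Euc m, fderiv ℝ V p X = a p • X + ψ p X • V p

section Hypersurface

variable {n : ℕ} {M : Type*} [TopologicalSpace M] [ChartedSpace (Euc n) M]

/-- A smooth immersion of `M` into the sphere. -/
structure IsSmoothImmersion (φ : M → USphere n) : Prop where
  smooth : ContMDiff (𝓡 n) (𝓡 (n + 1)) ∞ φ
  injective : ∀ x : M, Function.Injective (mfderiv (𝓡 n) (𝓡 (n + 1)) φ x)

/-- The differential of `φ`, with tangent vectors of the sphere regarded as vectors of `𝔼ⁿ⁺²`. -/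
def diff (φ : M → USphere n) (x : M) (X : TangentSpace (𝓡 n) x) : Euc (n + 1 + 1) :=
  mvfderiv (𝓡 n) (fun y => (φ y : Euc (n + 1 + 1))) x X

/-- The induced metric on `M`. -/
def inducedMetric (φ : M → USphere n) : Tensor2 n M := fun x X Y =>
  ⟪diff φ x X, diff φ x Y⟫_ℝ

/-- `N` is a smooth unit normal vector field of the hypersurface `φ` in the sphere. -/
structure IsUnitNormal (φ : M → USphere n) (N : M → Euc (n + 1 + 1)) : Prop where
  smooth : ContMDiff (𝓡 n) 𝓘(ℝ, Euc (n + 1 + 1)) ∞ N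
  norm_eq_one : ∀ x : M, ‖N x‖ = 1
  tangent_sphere : ∀ x : M, ⟪N x, (φ x : Euc (n + 1 + 1))⟫_ℝ = 0
  normal : ∀ (x : M) (X : TangentSpace (𝓡 n) x), ⟪N x, diff φ x X⟫_ℝ = 0

/-- The Levi-Civita connection of the sphere along `φ`: the part of the Euclidean derivative
of `Z` in the direction `X` that is tangent to the sphere. -/
def sphereCov (φ : M → USphere n) (Z : M → Euc (n + 1 + 1)) (x : M)
    (X : TangentSpace (𝓡 n) x) : Euc (n + 1 + 1) :=
  mvfderiv (𝓡 n) Z x X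
    - ⟪mvfderiv (𝓡 n) Z x X, (φ x : Euc (n + 1 + 1))⟫_ℝ • (φ x : Euc (n + 1 + 1))

/-- The second fundamental tensor field `H(X, Y) = g(B X, Y)`, where the shape operator `B` is
given by the Weingarten formula `∇̄_X N = - B X` in the sphere. -/
def secondFund (φ : M → USphere n) (N : M → Euc (n + 1 + 1)) : Tensor2 n M := fun x X Y =>
  ⟪- sphereCov φ N x X, diff φ x Y⟫_ℝ

/-- The tangential component to the sphere, at its point `p`, of a vector field on `𝔼ⁿ⁺²`. -/
def tangentSphere (V : Euc (n + 1 + 1) → Euc (n + 1 + 1)) (p : USphere n) : Euc (n + 1 + 1) :=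
  V p - ⟪V p, (p : Euc (n + 1 + 1))⟫_ℝ • (p : Euc (n + 1 + 1))

/-- The tangential component `U` on `M` of a vector field `ξ` on the sphere: `U x` is the vector
with `⟨dφ U, dφ X⟩ = ⟨ξ, dφ X⟩` for all `X` tangent to `M` at `x`. -/
def tangentPart (φ : M → USphere n) (ξ : USphere n → Euc (n + 1 + 1)) : VField n M := fun x =>
  sharp (inducedMetric φ) x fun X => ⟪ξ (φ x), diff φ x X⟫_ℝ

end Hypersurface

end

end SphereSoliton

/-! In a chart the hypersurface is a map `F` from an open set of `ℝⁿ` to the unit sphere with unit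
normal `ν`, and the vectors `∂_i F`, `ν`, `F` form a basis of `𝔼ⁿ⁺²`. Two computations in this basis
carry the theorem. Write `g` and `h` for the components of the first and second fundamental forms.

Curvature: expanding second derivatives gives the Gauss formula `∂_i ∂_j F = Γ^k_{ij} ∂_k F + h_{ij}
ν - g_{ij} F` (`gauss_formula`). Differentiating once more and using that third derivatives commute
yields `gauss_equation`. Contraction gives `Ric = tr(H) H - H² + (n - 1) g` (`Ric_eq`), and then
`scal = n(n - 1) + tr(H)² - tr(H²)` (`scal_eq`).

Lie derivative: `U` is determined by `g(U, ∂_j) = ⟨V, ∂_j F⟩`. Differentiating this with `D_X V = aX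
+ ψ(X)V` and `V = U + δν + ϱF` gives `½ £_U g = (a - ϱ) g + δ H + ½ (ψ ⊗ U♭ + U♭ ⊗ ψ)`
(`lieDeriv_eq`).

Substituted into the soliton equations, these formulas turn both equivalences into rearrangements.
For the umbilicity claim, `H` is split into its pure trace `(tr(H)/n) g` and its trace-free part,
with `β = 0`. This avoids dividing by `δ`, which may vanish. The work lies in showing that these
pieces are smooth (`isPseudoQuasiUmbilical`). -/

namespace SphereSoliton

noncomputable section

/-! ### Smoothness of determinants and inverse matrices -/

section MatrixSmooth

variable {E ι : Type*} [NormedAddCommGroup E] [NormedSpace ℝ E] [Fintype ι] [DecidableEq ι]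

theorem contDiffAt_det {A : E → Matrix ι ι ℝ} {p : E}
    (hA : ∀ i j, ContDiffAt ℝ ∞ (fun q => A q i j) p) : ContDiffAt ℝ ∞ (fun q => (A q).det) p := by
  simp only [Matrix.det_apply]
  exact ContDiffAt.sum fun σ _ => (contDiffAt_prod fun i _ => hA (σ i) i).const_smul _

/-- Cramer's rule: an entry of the inverse is a cofactor over the determinant, and a cofactor is the
determinant of the matrix with one row replaced by a constant one. -/
theorem contDiffAt_inv_apply {A : E → Matrix ι ι ℝ} {p : E}
    (hA : ∀ i j, ContDiffAt ℝ ∞ (fun q => A q i j) p) (hp : (A p).det ≠ 0) (i j : ι) :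
    ContDiffAt ℝ ∞ (fun q => (A q)⁻¹ i j) p := by
  simp only [Matrix.inv_def, Ring.inverse_eq_inv', Matrix.smul_apply, smul_eq_mul,
    Matrix.adjugate_apply]
  refine ((contDiffAt_det hA).inv hp).mul (contDiffAt_det fun k l => ?_)
  by_cases hk : k = j
  · subst hk; simpa using contDiffAt_const
  · simpa [Matrix.updateRow_ne hk] using hA k l

end MatrixSmooth

/-! ### Calculus of coordinate derivatives -/

section PartialDerivatives

variable {n : ℕ} {W : Type*} [NormedAddCommGroup W] [InnerProductSpace ℝ W]

/-- The partial derivative `∂_i f` of a vector-valued function. -/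
def vpd (i : Fin n) (f : Euc n → W) (p : Euc n) : W :=
  fderiv ℝ f p (EuclideanSpace.single i (1 : ℝ))

theorem contDiffAt_vpd {f : Euc n → W} {p : Euc n} (hf : ContDiffAt ℝ ∞ f p) (i : Fin n) :
    ContDiffAt ℝ ∞ (vpd i f) p :=
  (hf.fderiv_right (m := ∞) (by simp)).clm_apply contDiffAt_const

theorem differentiableAt_vpd {f : Euc n → W} {p : Euc n} (hf : ContDiffAt ℝ ∞ f p) (i : Fin n) :
    DifferentiableAt ℝ (vpd i f) p :=
  (contDiffAt_vpd hf i).differentiableAt (by simp)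

theorem pd_inner {f h : Euc n → W} {p : Euc n} (hf : DifferentiableAt ℝ f p)
    (hh : DifferentiableAt ℝ h p) (i : Fin n) :
    pd i (fun q => ⟪f q, h q⟫_ℝ) p = ⟪vpd i f p, h p⟫_ℝ + ⟪f p, vpd i h p⟫_ℝ := by
  simp [pd, vpd, fderiv_inner_apply ℝ hf hh, add_comm]

theorem inner_eq_zero_of_mem_span {ι : Type*} {b : ι → W} {w u : W}
    (hw : w ∈ Submodule.span ℝ (Set.range b)) (hu : ∀ i, ⟪u, b i⟫_ℝ = 0) : ⟪u, w⟫_ℝ = 0 := by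
  induction hw using Submodule.span_induction with
  | mem x hx => obtain ⟨i, rfl⟩ := hx; exact hu i
  | zero => simp
  | add x y _ _ hx hy => rw [inner_add_right, hx, hy, add_zero]
  | smul c x _ hx => rw [inner_smul_right, hx, mul_zero]

theorem vpd_comm {f : Euc n → W} {p : Euc n} (hf : ContDiffAt ℝ ∞ f p) (i j : Fin n) :
    vpd i (vpd j f) p = vpd j (vpd i f) p := by
  have h : ∀ a b : Fin n, vpd a (vpd b f) p
      = fderiv ℝ (fderiv ℝ f) p (EuclideanSpace.single a 1) (EuclideanSpace.single b 1) := by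
    intro a b
    have hd : DifferentiableAt ℝ (fderiv ℝ f) p :=
      (hf.fderiv_right (m := ∞) (by simp)).differentiableAt (by simp)
    have := fderiv_clm_apply hd (differentiableAt_const (EuclideanSpace.single b (1 : ℝ)))
    unfold vpd
    rw [this]; simp
  rw [h, h]
  refine (hf.isSymmSndFDerivAt ?_) _ _
  rw [minSmoothness_of_isRCLikeNormedField]
  exact WithTop.coe_le_coe.mpr le_top

theorem fderiv_eq_sum_vpd (f : Euc n → W) (p v : Euc n) :
    fderiv ℝ f p v = ∑ i, v i • vpd i f p := by
  conv_lhs => rw [← (EuclideanSpace.basisFun (Fin n) ℝ).sum_repr v]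
  simp [vpd]

theorem pd_mul {f h : Euc n → ℝ} {p : Euc n} (hf : DifferentiableAt ℝ f p)
    (hh : DifferentiableAt ℝ h p) (i : Fin n) :
    pd i (fun q => f q * h q) p = pd i f p * h p + f p * pd i h p := by
  simp [pd, fderiv_fun_mul hf hh]; ring

theorem pd_congr {f h : Euc n → ℝ} {p : Euc n} (e : f =ᶠ[nhds p] h) (i : Fin n) :
    pd i f p = pd i h p := by
  simp [pd, e.fderiv_eq]

theorem vpd_congr {f h : Euc n → W} {p : Euc n} (e : f =ᶠ[nhds p] h) (i : Fin n) :
    vpd i f p = vpd i h p := by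
  simp [vpd, e.fderiv_eq]

end PartialDerivatives

/-! ### Parametrized hypersurfaces of the unit sphere -/

section LocalHypersurface

variable {n : ℕ}

/-- A parametrized hypersurface `F : S → 𝕊ⁿ⁺¹(1)`, on an open set `S` of `ℝⁿ`, with unit
normal `ν`. -/
structure IsLocalHypersurface (S : Set (Euc n)) (F ν : Euc n → Euc (n + 1 + 1)) : Prop where
  isOpen : IsOpen S
  smooth : ∀ p ∈ S, ContDiffAt ℝ ∞ F p
  smooth_normal : ∀ p ∈ S, ContDiffAt ℝ ∞ ν p
  unit : ∀ p ∈ S, ⟪F p, F p⟫_ℝ = 1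
  unit_normal : ∀ p ∈ S, ⟪ν p, ν p⟫_ℝ = 1
  normal_position : ∀ p ∈ S, ⟪ν p, F p⟫_ℝ = 0
  normal_tangent : ∀ p ∈ S, ∀ i, ⟪ν p, vpd i F p⟫_ℝ = 0
  injective : ∀ p ∈ S, Function.Injective (fderiv ℝ F p)

/-- The first fundamental form `⟨∂_i F, ∂_j F⟩`. -/
def firstForm (F : Euc n → Euc (n + 1 + 1)) (p : Euc n) : Matrix (Fin n) (Fin n) ℝ :=
  Matrix.of fun i j => ⟪vpd i F p, vpd j F p⟫_ℝ

/-- The second fundamental form `-⟨∂_i ν, ∂_j F⟩`. -/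
def secondForm (F ν : Euc n → Euc (n + 1 + 1)) (p : Euc n) : Matrix (Fin n) (Fin n) ℝ :=
  Matrix.of fun i j => -⟪vpd i ν p, vpd j F p⟫_ℝ

variable {S : Set (Euc n)} {F ν : Euc n → Euc (n + 1 + 1)} {p : Euc n}

theorem firstForm_apply (i j : Fin n) : firstForm F p i j = ⟪vpd i F p, vpd j F p⟫_ℝ := rfl

theorem secondForm_apply (i j : Fin n) : secondForm F ν p i j = -⟪vpd i ν p, vpd j F p⟫_ℝ := rfl

theorem firstForm_symm (i j : Fin n) : firstForm F p i j = firstForm F p j i := by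
  rw [firstForm_apply, firstForm_apply, real_inner_comm]

theorem firstForm_transpose : (firstForm F p).transpose = firstForm F p := by
  ext i j; exact firstForm_symm j i

theorem firstForm_inv_symm (i j : Fin n) : (firstForm F p)⁻¹ i j = (firstForm F p)⁻¹ j i := by
  conv_lhs => rw [← firstForm_transpose, ← Matrix.transpose_nonsing_inv]
  rfl

namespace IsLocalHypersurface

/-- A kernel vector `v` of the Gram matrix satisfies `|dF(v)|² = vᵀ G v = 0`, so injectivity of `dF`
forces `v = 0`. -/
theorem det_ne_zero (h : IsLocalHypersurface S F ν) (hp : p ∈ S) : (firstForm F p).det ≠ 0 := by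
  intro h0
  obtain ⟨v, hv, hv0⟩ := Matrix.exists_mulVec_eq_zero_iff.mpr h0
  apply hv
  have key : ⟪fderiv ℝ F p (WithLp.toLp 2 v), fderiv ℝ F p (WithLp.toLp 2 v)⟫_ℝ = 0 := by
    rw [fderiv_eq_sum_vpd, sum_inner]
    simp only [inner_sum, inner_smul_left, inner_smul_right]
    refine Finset.sum_eq_zero fun i _ => ?_
    have := congrFun hv0 i
    simp only [Matrix.mulVec, dotProduct, firstForm_apply, Pi.zero_apply] at this
    simp only [RCLike.conj_to_real]
    rw [← mul_zero (v i), ← this, Finset.mul_sum]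
    exact Finset.sum_congr rfl fun j _ => by ring
  have h1 : fderiv ℝ F p (WithLp.toLp 2 v) = fderiv ℝ F p 0 := by
    rw [map_zero]; exact inner_self_eq_zero.mp key
  have := h.injective p hp h1
  ext i
  simpa using congrArg (fun w : Euc n => w i) this

theorem inv_mul (h : IsLocalHypersurface S F ν) (hp : p ∈ S) (i k : Fin n) :
    ∑ j, (firstForm F p)⁻¹ i j * firstForm F p j k = if i = k then 1 else 0 := by
  have := congrFun (congrFun (Matrix.nonsing_inv_mul (firstForm F p)
    (isUnit_iff_ne_zero.mpr (h.det_ne_zero hp))) i) k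
  simpa [Matrix.mul_apply, Matrix.one_apply] using this

theorem mul_inv (h : IsLocalHypersurface S F ν) (hp : p ∈ S) (i k : Fin n) :
    ∑ j, firstForm F p i j * (firstForm F p)⁻¹ j k = if i = k then 1 else 0 := by
  have := congrFun (congrFun (Matrix.mul_nonsing_inv (firstForm F p)
    (isUnit_iff_ne_zero.mpr (h.det_ne_zero hp))) i) k
  simpa [Matrix.mul_apply, Matrix.one_apply] using this

theorem mem_nhds (h : IsLocalHypersurface S F ν) (hp : p ∈ S) : S ∈ nhds p :=
  h.isOpen.mem_nhds hp

/-- Differentiate `⟨F, F⟩ = 1`. The next two identities arise likewise from `⟨F, ∂_j F⟩ = 0` and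
`⟨ν, ∂_j F⟩ = 0`. -/
theorem inner_position_vpd (h : IsLocalHypersurface S F ν) (hp : p ∈ S) (i : Fin n) :
    ⟪F p, vpd i F p⟫_ℝ = 0 := by
  have hd := (h.smooth p hp).differentiableAt (by simp)
  have h1 := pd_inner hd hd i
  have h2 : pd i (fun q => ⟪F q, F q⟫_ℝ) p = 0 := by
    rw [pd_congr (Filter.eventually_of_mem (h.mem_nhds hp) h.unit) i]
    simp [pd]
  rw [h2, real_inner_comm] at h1
  linarith

theorem inner_position_vpd_vpd (h : IsLocalHypersurface S F ν) (hp : p ∈ S) (i j : Fin n) :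
    ⟪F p, vpd i (vpd j F) p⟫_ℝ = -firstForm F p i j := by
  have hd := (h.smooth p hp).differentiableAt (by simp)
  have h1 := pd_inner hd (differentiableAt_vpd (h.smooth p hp) j) i
  have h2 : pd i (fun q => ⟪F q, vpd j F q⟫_ℝ) p = 0 := by
    rw [pd_congr (Filter.eventually_of_mem (h.mem_nhds hp)
      fun q hq => h.inner_position_vpd hq j) i]
    simp [pd]
  rw [h2] at h1
  rw [firstForm_apply]
  linarith

theorem inner_normal_vpd_vpd (h : IsLocalHypersurface S F ν) (hp : p ∈ S) (i j : Fin n) :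
    ⟪ν p, vpd i (vpd j F) p⟫_ℝ = secondForm F ν p i j := by
  have hd := (h.smooth_normal p hp).differentiableAt (by simp)
  have h1 := pd_inner hd (differentiableAt_vpd (h.smooth p hp) j) i
  have h2 : pd i (fun q => ⟪ν q, vpd j F q⟫_ℝ) p = 0 := by
    rw [pd_congr (Filter.eventually_of_mem (h.mem_nhds hp)
      fun q hq => h.normal_tangent q hq j) i]
    simp [pd]
  rw [h2] at h1
  rw [secondForm_apply]
  linarith

theorem secondForm_symm (h : IsLocalHypersurface S F ν) (hp : p ∈ S) (i j : Fin n) :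
    secondForm F ν p i j = secondForm F ν p j i := by
  rw [← h.inner_normal_vpd_vpd hp, ← h.inner_normal_vpd_vpd hp, vpd_comm (h.smooth p hp)]

/-- The `n + 2` vectors `∂_i F`, `ν`, `F` are independent, since each of the last two is a unit
vector orthogonal to the preceding ones. Hence they span, and `z` is orthogonal to itself. -/
theorem eq_zero_of_inner (h : IsLocalHypersurface S F ν) (hp : p ∈ S) (z : Euc (n + 1 + 1))
    (hz : ∀ i, ⟪z, vpd i F p⟫_ℝ = 0) (hν : ⟪z, ν p⟫_ℝ = 0) (hF : ⟪z, F p⟫_ℝ = 0) : z = 0 := by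
  have hli : LinearIndependent ℝ (fun i => vpd i F p) := by
    have := (EuclideanSpace.basisFun (Fin n) ℝ).toBasis.linearIndependent.map'
      (fderiv ℝ F p : Euc n →ₗ[ℝ] Euc (n + 1 + 1)) (LinearMap.ker_eq_bot.mpr (h.injective p hp))
    refine (linearIndependent_iff'.mpr ?_)
    intro t c hc i hi
    refine linearIndependent_iff'.mp this t c ?_ i hi
    rw [← hc]
    simp [vpd]
  have hli1 : LinearIndependent ℝ (Fin.cons (ν p) fun i => vpd i F p : Fin (n + 1) → _) := by
    refine hli.finCons fun hm => ?_
    have := inner_eq_zero_of_mem_span hm (h.normal_tangent p hp)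
    rw [h.unit_normal p hp] at this
    exact one_ne_zero this
  have hFν : ⟪F p, ν p⟫_ℝ = 0 := by rw [real_inner_comm]; exact h.normal_position p hp
  have hli2 : LinearIndependent ℝ
      (Fin.cons (F p) (Fin.cons (ν p) fun i => vpd i F p : Fin (n + 1) → _) :
        Fin (n + 1 + 1) → Euc (n + 1 + 1)) := by
    refine hli1.finCons fun hm => ?_
    have := inner_eq_zero_of_mem_span hm
      (Fin.cases (by simpa using hFν) (by simpa using h.inner_position_vpd hp))
    rw [h.unit p hp] at this
    exact one_ne_zero this
  have htop := hli2.span_eq_top_of_card_eq_finrank' (by simp)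
  exact inner_self_eq_zero.mp (inner_eq_zero_of_mem_span (htop ▸ Submodule.mem_top)
    (Fin.cases (by simpa using hF) (Fin.cases (by simpa using hν) (by simpa using hz))))

/-- The tangential coefficients enter only through the linear system they solve, so both the
Christoffel symbols and the components of `U` can be inserted. -/
theorem eq_of_inner (h : IsLocalHypersurface S F ν) (hp : p ∈ S) (z : Euc (n + 1 + 1))
    (u : Fin n → ℝ)
    (hz : ∀ j, ∑ k, firstForm F p k j * u k = ⟪z, vpd j F p⟫_ℝ) :
    z = ∑ k, u k • vpd k F p + ⟪z, ν p⟫_ℝ • ν p + ⟪z, F p⟫_ℝ • F p := by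
  rw [← sub_eq_zero]
  have hFν : ⟪F p, ν p⟫_ℝ = 0 := by rw [real_inner_comm]; exact h.normal_position p hp
  apply h.eq_zero_of_inner hp
  · intro j
    simp only [inner_sub_left, inner_add_left, sum_inner, inner_smul_left, RCLike.conj_to_real,
      h.normal_tangent p hp, h.inner_position_vpd hp, ← hz, firstForm_apply]
    simp [mul_comm]
  · have ht : ∀ k, ⟪vpd k F p, ν p⟫_ℝ = 0 := fun k => by
      rw [real_inner_comm]; exact h.normal_tangent p hp k
    simp only [inner_sub_left, inner_add_left, sum_inner, inner_smul_left, RCLike.conj_to_real,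
      h.unit_normal p hp, hFν, ht]
    simp
  · have ht : ∀ k, ⟪vpd k F p, F p⟫_ℝ = 0 := fun k => by
      rw [real_inner_comm]; exact h.inner_position_vpd hp k
    simp only [inner_sub_left, inner_add_left, sum_inner, inner_smul_left, RCLike.conj_to_real,
      h.unit p hp, h.normal_position p hp, ht]
    simp

theorem contDiffAt_firstForm (h : IsLocalHypersurface S F ν) (hp : p ∈ S) (i j : Fin n) :
    ContDiffAt ℝ ∞ (fun q => firstForm F q i j) p :=
  (contDiffAt_vpd (h.smooth p hp) i).inner ℝ (contDiffAt_vpd (h.smooth p hp) j)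

theorem contDiffAt_secondForm (h : IsLocalHypersurface S F ν) (hp : p ∈ S) (i j : Fin n) :
    ContDiffAt ℝ ∞ (fun q => secondForm F ν q i j) p :=
  ((contDiffAt_vpd (h.smooth_normal p hp) i).inner ℝ (contDiffAt_vpd (h.smooth p hp) j)).neg

theorem contDiffAt_inv_firstForm (h : IsLocalHypersurface S F ν) (hp : p ∈ S) (i j : Fin n) :
    ContDiffAt ℝ ∞ (fun q => (firstForm F q)⁻¹ i j) p :=
  contDiffAt_inv_apply (h.contDiffAt_firstForm hp) (h.det_ne_zero hp) i j

theorem pd_firstForm (h : IsLocalHypersurface S F ν) (hp : p ∈ S) (i j k : Fin n) :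
    pd k (fun q => firstForm F q i j) p
      = ⟪vpd k (vpd i F) p, vpd j F p⟫_ℝ + ⟪vpd i F p, vpd k (vpd j F) p⟫_ℝ :=
  pd_inner (differentiableAt_vpd (h.smooth p hp) i) (differentiableAt_vpd (h.smooth p hp) j) k

/-- The product rule expands the three metric derivatives into six terms; by symmetry of second
derivatives four cancel and the other two coincide. -/
theorem christoffel_eq (h : IsLocalHypersurface S F ν) (hp : p ∈ S) (k i j : Fin n) :
    christoffel (firstForm F) k i j p
      = ∑ l, (firstForm F p)⁻¹ k l * ⟪vpd i (vpd j F) p, vpd l F p⟫_ℝ := by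
  unfold christoffel
  rw [Finset.mul_sum]
  refine Finset.sum_congr rfl fun l _ => ?_
  rw [h.pd_firstForm hp, h.pd_firstForm hp, h.pd_firstForm hp, vpd_comm (h.smooth p hp) j i,
    vpd_comm (h.smooth p hp) l i, vpd_comm (h.smooth p hp) l j,
    real_inner_comm (vpd i (vpd l F) p), real_inner_comm (vpd j (vpd l F) p)]
  rw [real_inner_comm (vpd j F p) (vpd i (vpd l F) p)]
  ring

theorem sum_firstForm_christoffel (h : IsLocalHypersurface S F ν) (hp : p ∈ S) (i j l : Fin n) :
    ∑ k, firstForm F p k l * christoffel (firstForm F) k i j p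
      = ⟪vpd i (vpd j F) p, vpd l F p⟫_ℝ := by
  simp only [h.christoffel_eq hp, Finset.mul_sum]
  rw [Finset.sum_comm]
  simp only [← mul_assoc, ← Finset.sum_mul]
  simp only [firstForm_symm _ l, h.mul_inv hp]
  simp

theorem gauss_formula (h : IsLocalHypersurface S F ν) (hp : p ∈ S) (i j : Fin n) :
    vpd i (vpd j F) p = ∑ k, christoffel (firstForm F) k i j p • vpd k F p
      + secondForm F ν p i j • ν p - firstForm F p i j • F p := by
  conv_lhs => rw [h.eq_of_inner hp (vpd i (vpd j F) p) (fun k => christoffel (firstForm F) k i j p)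
    (h.sum_firstForm_christoffel hp i j)]
  rw [real_inner_comm, h.inner_normal_vpd_vpd hp, real_inner_comm, h.inner_position_vpd_vpd hp]
  module

theorem differentiableAt_christoffel (h : IsLocalHypersurface S F ν) (hp : p ∈ S) (k i j : Fin n) :
    DifferentiableAt ℝ (christoffel (firstForm F) k i j) p := by
  have : ContDiffAt ℝ ∞ (fun q => ∑ l, (firstForm F q)⁻¹ k l
      * ⟪vpd i (vpd j F) q, vpd l F q⟫_ℝ) p :=
    ContDiffAt.sum fun l _ => (h.contDiffAt_inv_firstForm hp k l).mul
      ((contDiffAt_vpd (contDiffAt_vpd (h.smooth p hp) j) i).inner ℝ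
        (contDiffAt_vpd (h.smooth p hp) l))
  refine (this.differentiableAt (by simp)).congr_of_eventuallyEq ?_
  exact Filter.eventually_of_mem (h.mem_nhds hp) fun q hq => h.christoffel_eq hq k i j

/-- The third derivatives of `F`, tangential part. -/
theorem inner_vpd_vpd_vpd (h : IsLocalHypersurface S F ν) (hp : p ∈ S) (i j k l : Fin n) :
    ⟪vpd i (vpd j (vpd k F)) p, vpd l F p⟫_ℝ
      = ∑ m, firstForm F p m l * (pd i (christoffel (firstForm F) m j k) p
          + ∑ s, christoffel (firstForm F) m i s p * christoffel (firstForm F) s j k p)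
        - secondForm F ν p j k * secondForm F ν p i l - firstForm F p j k * firstForm F p i l := by
  have hΓ := h.differentiableAt_christoffel hp
  have hF := h.smooth p hp
  -- The Gauss formula holds on a whole neighbourhood, so it may be differentiated.
  have e : (fun q => vpd j (vpd k F) q) =ᶠ[nhds p] fun q =>
      ∑ m, christoffel (firstForm F) m j k q • vpd m F q
      + secondForm F ν q j k • ν q - firstForm F q j k • F q :=
    Filter.eventually_of_mem (h.mem_nhds hp) fun q hq => h.gauss_formula hq j k
  have hH := (h.contDiffAt_secondForm hp j k).differentiableAt (by simp)
  have hG := (h.contDiffAt_firstForm hp j k).differentiableAt (by simp)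
  have hν := (h.smooth_normal p hp).differentiableAt (by simp)
  have hFd := hF.differentiableAt (by simp)
  have hs : ∀ m ∈ Finset.univ, HasFDerivAt
      (fun q => christoffel (firstForm F) m j k q • vpd m F q) _ p := fun m _ =>
    (hΓ m j k).hasFDerivAt.smul (differentiableAt_vpd hF m).hasFDerivAt
  have hd := ((HasFDerivAt.fun_sum hs).add (hH.hasFDerivAt.smul hν.hasFDerivAt)).sub
    (hG.hasFDerivAt.smul hFd.hasFDerivAt)
  rw [vpd_congr e i]
  unfold vpd
  erw [hd.fderiv]
  simp only [sub_apply, add_apply, sum_apply, smul_apply,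
    ContinuousLinearMap.smulRight_apply]
  change ⟪(∑ m, (christoffel (firstForm F) m j k p • vpd i (vpd m F) p
      + pd i (christoffel (firstForm F) m j k) p • vpd m F p)
      + (secondForm F ν p j k • vpd i ν p + pd i (fun q => secondForm F ν q j k) p • ν p))
      - (firstForm F p j k • vpd i F p + pd i (fun q => firstForm F q j k) p • F p),
      vpd l F p⟫_ℝ = _
  -- Pairing with `∂_l F` removes the undifferentiated `ν` and `F`; their derivatives contribute the
  -- products of fundamental forms.
  simp only [inner_sub_left, inner_add_left, sum_inner, inner_smul_left, RCLike.conj_to_real,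
    h.normal_tangent p hp, h.inner_position_vpd hp]
  rw [show ⟪vpd i ν p, vpd l F p⟫_ℝ = -secondForm F ν p i l by rw [secondForm_apply]; ring]
  simp only [← firstForm_apply, ← h.sum_firstForm_christoffel hp i _ l, mul_add,
    Finset.sum_add_distrib, Finset.mul_sum]
  rw [Finset.sum_comm (f := fun m s => firstForm F p m l * _)]
  have e1 : ∑ m, ∑ i_1, christoffel (firstForm F) m j k p
        * (firstForm F p i_1 l * christoffel (firstForm F) i_1 i m p)
      = ∑ y, ∑ x, firstForm F p x l
        * (christoffel (firstForm F) x i y p * christoffel (firstForm F) y j k p) :=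
    Finset.sum_congr rfl fun _ _ => Finset.sum_congr rfl fun _ _ => by ring
  have e2 : ∑ m, pd i (christoffel (firstForm F) m j k) p * firstForm F p m l
      = ∑ m, firstForm F p m l * pd i (christoffel (firstForm F) m j k) p :=
    Finset.sum_congr rfl fun _ _ => by ring
  rw [e1, e2]
  ring

/-- Antisymmetrizing the tangential part of `∂_i ∂_j ∂_k F` in `i, j` gives zero, and the
Christoffel terms that appear are exactly the curvature. -/
theorem gauss_equation (h : IsLocalHypersurface S F ν) (hp : p ∈ S) (i j k l : Fin n) :
    ∑ m, firstForm F p m l * riemann (firstForm F) m i j k p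
      = secondForm F ν p j k * secondForm F ν p i l - secondForm F ν p i k * secondForm F ν p j l
        + firstForm F p j k * firstForm F p i l - firstForm F p i k * firstForm F p j l := by
  have h1 := h.inner_vpd_vpd_vpd hp i j k l
  have h2 := h.inner_vpd_vpd_vpd hp j i k l
  rw [vpd_comm (contDiffAt_vpd (h.smooth p hp) k) i j, h2] at h1
  have e : ∑ m, firstForm F p m l * riemann (firstForm F) m i j k p
      = ∑ m, firstForm F p m l * (pd i (christoffel (firstForm F) m j k) p
          + ∑ s, christoffel (firstForm F) m i s p * christoffel (firstForm F) s j k p)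
        - ∑ m, firstForm F p m l * (pd j (christoffel (firstForm F) m i k) p
          + ∑ s, christoffel (firstForm F) m j s p * christoffel (firstForm F) s i k p) := by
    rw [← Finset.sum_sub_distrib]
    refine Finset.sum_congr rfl fun m _ => ?_
    unfold riemann
    rw [Finset.sum_sub_distrib]
    ring
  rw [e]
  linarith

theorem riemann_eq (h : IsLocalHypersurface S F ν) (hp : p ∈ S) (i j k m : Fin n) :
    riemann (firstForm F) m i j k p = ∑ l, (firstForm F p)⁻¹ m l
      * (secondForm F ν p j k * secondForm F ν p i l - secondForm F ν p i k * secondForm F ν p j l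
        + firstForm F p j k * firstForm F p i l - firstForm F p i k * firstForm F p j l) := by
  simp only [← h.gauss_equation hp, Finset.mul_sum]
  rw [Finset.sum_comm]
  simp only [← mul_assoc, ← Finset.sum_mul]
  have e : ∀ s, ∑ l, (firstForm F p)⁻¹ m l * firstForm F p s l = if m = s then 1 else 0 := by
    intro s
    rw [← h.inv_mul hp m s]
    exact Finset.sum_congr rfl fun l _ => by rw [firstForm_symm s l]
  simp only [e]
  simp

/-- The Ricci tensor of a hypersurface of the unit sphere. -/
theorem ricci_eq (h : IsLocalHypersurface S F ν) (hp : p ∈ S) (j k : Fin n) :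
    ∑ i, riemann (firstForm F) i i j k p
      = (∑ i, ∑ l, (firstForm F p)⁻¹ i l * secondForm F ν p i l) * secondForm F ν p j k
        - ∑ i, ∑ l, (firstForm F p)⁻¹ i l * secondForm F ν p j i * secondForm F ν p l k
        + ((n : ℝ) - 1) * firstForm F p j k := by
  have e1 : ∀ i, ∑ l, (firstForm F p)⁻¹ i l * firstForm F p i l = 1 := by
    intro i
    have := h.inv_mul hp i i
    simpa [firstForm_symm i] using this
  -- This contraction contributes one copy of `g_{jk}` with a minus sign and `e4` contributes `n`
  -- copies, whence the factor `n - 1`.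
  have e2 : ∑ i, ∑ l, (firstForm F p)⁻¹ i l * (firstForm F p i k * firstForm F p j l)
      = firstForm F p j k := by
    have : ∀ i, ∑ l, (firstForm F p)⁻¹ i l * (firstForm F p i k * firstForm F p j l)
        = firstForm F p i k * if i = j then 1 else 0 := by
      intro i
      rw [← h.inv_mul hp i j, Finset.mul_sum]
      exact Finset.sum_congr rfl fun l _ => by rw [firstForm_symm j l]; ring
    simp [this]
  have e3 : ∑ i, ∑ l, (firstForm F p)⁻¹ i l * (secondForm F ν p i k * secondForm F ν p j l)
      = ∑ i, ∑ l, (firstForm F p)⁻¹ i l * secondForm F ν p j i * secondForm F ν p l k := by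
    rw [Finset.sum_comm]
    exact Finset.sum_congr rfl fun i _ => Finset.sum_congr rfl fun l _ => by
      rw [firstForm_inv_symm l i]; ring
  have e4 : ∑ i, ∑ l, (firstForm F p)⁻¹ i l * (firstForm F p j k * firstForm F p i l)
      = n * firstForm F p j k := by
    have : ∀ i, ∑ l, (firstForm F p)⁻¹ i l * (firstForm F p j k * firstForm F p i l)
        = firstForm F p j k := by
      intro i
      conv_rhs => rw [← mul_one (firstForm F p j k), ← e1 i, Finset.mul_sum]
      exact Finset.sum_congr rfl fun l _ => by ring
    simp [this]
  have e5 : ∑ i, ∑ l, (firstForm F p)⁻¹ i l * (secondForm F ν p j k * secondForm F ν p i l)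
      = (∑ i, ∑ l, (firstForm F p)⁻¹ i l * secondForm F ν p i l) * secondForm F ν p j k := by
    rw [Finset.sum_mul]
    refine Finset.sum_congr rfl fun i _ => ?_
    rw [Finset.sum_mul]
    exact Finset.sum_congr rfl fun l _ => by ring
  simp only [h.riemann_eq hp, mul_sub, mul_add, Finset.sum_sub_distrib, Finset.sum_add_distrib]
  rw [e2, e3, e4, e5]
  ring

/-- The Lie derivative of the first fundamental form along the tangential part `u` of a
torse-forming vector field `V`. -/
theorem lie_eq (h : IsLocalHypersurface S F ν) (hp : p ∈ S)
    {V : Euc (n + 1 + 1) → Euc (n + 1 + 1)} {a : Euc (n + 1 + 1) → ℝ}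
    {ψ : Euc (n + 1 + 1) → (Euc (n + 1 + 1) →L[ℝ] ℝ)} (hV : IsTorseForming V a ψ)
    {u : Euc n → Euc n} (hu : ∀ k, DifferentiableAt ℝ (fun q => u q k) p)
    (huV : ∀ q ∈ S, ∀ j, ∑ k, firstForm F q k j * u q k = ⟪V (F q), vpd j F q⟫_ℝ) (i j : Fin n) :
    ∑ k, (u p k * pd k (fun q => firstForm F q i j) p
        + firstForm F p k j * pd i (fun q => u q k) p
        + firstForm F p i k * pd j (fun q => u q k) p)
      = 2 * (a (F p) - ⟪V (F p), F p⟫_ℝ) * firstForm F p i j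
        + 2 * ⟪V (F p), ν p⟫_ℝ * secondForm F ν p i j
        + ψ (F p) (vpd i F p) * ⟪V (F p), vpd j F p⟫_ℝ
        + ψ (F p) (vpd j F p) * ⟪V (F p), vpd i F p⟫_ℝ := by
  have hF := h.smooth p hp
  have hFd : DifferentiableAt ℝ F p := hF.differentiableAt (by simp)
  have hVd : DifferentiableAt ℝ V (F p) := hV.smooth_field.contDiffAt.differentiableAt (by simp)
  have hVF : DifferentiableAt ℝ (fun q => V (F q)) p := hVd.comp p hFd
  have hvpd : ∀ i, vpd i (fun q => V (F q)) p
      = a (F p) • vpd i F p + ψ (F p) (vpd i F p) • V (F p) := by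
    intro i
    have := fderiv_comp p hVd hFd
    change fderiv ℝ (V ∘ F) p _ = _
    rw [this, ContinuousLinearMap.comp_apply, hV.equation]
    rfl
  -- Differentiate `g_{kj} u^k = ⟨V ∘ F, ∂_j F⟩` along `∂_i` and solve for the terms containing `∂_i
  -- u^k`.
  have key : ∀ i j, ∑ k, firstForm F p k j * pd i (fun q => u q k) p
      = a (F p) * firstForm F p i j + ψ (F p) (vpd i F p) * ⟪V (F p), vpd j F p⟫_ℝ
        + ⟪V (F p), vpd i (vpd j F) p⟫_ℝ - ∑ k, pd i (fun q => firstForm F q k j) p * u p k := by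
    intro i j
    have hl : pd i (fun q => ∑ k, firstForm F q k j * u q k) p
        = ∑ k, (pd i (fun q => firstForm F q k j) p * u p k
          + firstForm F p k j * pd i (fun q => u q k) p) := by
      have hG := fun k => (h.contDiffAt_firstForm hp k j).differentiableAt (by simp)
      have : pd i (fun q => ∑ k, firstForm F q k j * u q k) p
          = ∑ k, pd i (fun q => firstForm F q k j * u q k) p := by
        unfold pd
        rw [fderiv_fun_sum fun k _ => (hG k).fun_mul (hu k)]
        simp
      rw [this]
      exact Finset.sum_congr rfl fun k _ => pd_mul (hG k) (hu k) i
    rw [pd_congr (Filter.eventually_of_mem (h.mem_nhds hp) fun q hq => huV q hq j) i,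
      pd_inner hVF (differentiableAt_vpd hF j), hvpd, inner_add_left, inner_smul_left,
      inner_smul_left, Finset.sum_add_distrib] at hl
    simp only [RCLike.conj_to_real] at hl
    rw [firstForm_apply]
    linarith
  have hdec := h.eq_of_inner hp (V (F p)) (fun k => u p k) (huV p hp)
  have hin : ⟪V (F p), vpd i (vpd j F) p⟫_ℝ = ∑ k, u p k * ⟪vpd k F p, vpd i (vpd j F) p⟫_ℝ
      + ⟪V (F p), ν p⟫_ℝ * secondForm F ν p i j - ⟪V (F p), F p⟫_ℝ * firstForm F p i j := by
    conv_lhs => rw [hdec]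
    simp only [inner_add_left, sum_inner, inner_smul_left, RCLike.conj_to_real,
      h.inner_normal_vpd_vpd hp, h.inner_position_vpd_vpd hp]
    ring
  have hin' : ⟪V (F p), vpd j (vpd i F) p⟫_ℝ = ⟪V (F p), vpd i (vpd j F) p⟫_ℝ := by
    rw [vpd_comm hF]
  -- This is the Koszul combination of metric derivatives. It cancels the tangential part of `2⟨V,
  -- ∂_i ∂_j F⟩` produced by the two uses of `key`, leaving only the `ν` and `F` parts.
  have hder : ∑ k, u p k * pd k (fun q => firstForm F q i j) p
      - ∑ k, pd i (fun q => firstForm F q k j) p * u p k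
      - ∑ k, pd j (fun q => firstForm F q k i) p * u p k
      = -2 * ∑ k, u p k * ⟪vpd k F p, vpd i (vpd j F) p⟫_ℝ := by
    rw [← Finset.sum_sub_distrib, ← Finset.sum_sub_distrib, Finset.mul_sum]
    refine Finset.sum_congr rfl fun k _ => ?_
    rw [h.pd_firstForm hp, h.pd_firstForm hp, h.pd_firstForm hp, vpd_comm hF i k,
      vpd_comm hF j k, vpd_comm hF j i, real_inner_comm (vpd k (vpd j F) p)]
    ring
  simp only [Finset.sum_add_distrib]
  have k2 := key j i
  rw [firstForm_symm j i] at k2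
  have k3 : ∑ k, firstForm F p i k * pd j (fun q => u q k) p
      = ∑ k, firstForm F p k i * pd j (fun q => u q k) p :=
    Finset.sum_congr rfl fun k _ => by rw [firstForm_symm i k]
  rw [key i j, k3, k2]
  linarith

end IsLocalHypersurface

end LocalHypersurface

/-! ### Passing between the manifold and its charts -/

section Charts

theorem contMDiffAt_of_comp_extChartAt {n : ℕ} {M : Type*} [TopologicalSpace M]
    [ChartedSpace (Euc n) M] {W : Type*} [NormedAddCommGroup W] [NormedSpace ℝ W] {f : M → W}
    {h : Euc n → W} (x₀ : M)
    (hh : ContDiffAt ℝ ∞ h (extChartAt (𝓡 n) x₀ x₀))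
    (hf : ∀ p ∈ (extChartAt (𝓡 n) x₀).target, f ((extChartAt (𝓡 n) x₀).symm p) = h p) :
    ContMDiffAt (𝓡 n) 𝓘(ℝ, W) ∞ f x₀ := by
  have := hh.contMDiffAt.comp x₀ (contMDiffAt_extChartAt (I := 𝓡 n) (x := x₀))
  refine this.congr_of_eventuallyEq ?_
  filter_upwards [extChartAt_source_mem_nhds (I := 𝓡 n) x₀] with y hy
  rw [Function.comp_apply, ← hf _ ((extChartAt (𝓡 n) x₀).map_source hy),
    (extChartAt (𝓡 n) x₀).left_inv hy]

variable {n : ℕ} {M : Type*} [TopologicalSpace M] [ChartedSpace (Euc n) M]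
  {W : Type*} [NormedAddCommGroup W] [InnerProductSpace ℝ W] [IsManifold (𝓡 n) ∞ M]

theorem contMDiffAt_extChartAt_symm (x₀ : M) {p : Euc n} (hp : p ∈ (extChartAt (𝓡 n) x₀).target) :
    ContMDiffAt 𝓘(ℝ, Euc n) (𝓡 n) ∞ (extChartAt (𝓡 n) x₀).symm p :=
  (contMDiffOn_extChartAt_symm x₀).contMDiffAt ((isOpen_extChartAt_target x₀).mem_nhds hp)

theorem contDiffAt_comp_extChartAt_symm {f : M → W} (hf : ContMDiff (𝓡 n) 𝓘(ℝ, W) ∞ f) (x₀ : M)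
    {p : Euc n} (hp : p ∈ (extChartAt (𝓡 n) x₀).target) :
    ContDiffAt ℝ ∞ (fun q => f ((extChartAt (𝓡 n) x₀).symm q)) p :=
  (hf.contMDiffAt.comp p (contMDiffAt_extChartAt_symm x₀ hp)).contDiffAt

/-- The differential in the coordinates of the chart at `x₀`. -/
theorem mvfderiv_mfderiv_extChartAt_symm {f : M → W} (hf : ContMDiff (𝓡 n) 𝓘(ℝ, W) ∞ f) (x₀ : M)
    {p : Euc n} (hp : p ∈ (extChartAt (𝓡 n) x₀).target) {y : M}
    (hy : (extChartAt (𝓡 n) x₀).symm p = y) (v : Euc n) :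
    mvfderiv (𝓡 n) f y (mfderiv 𝓘(ℝ, Euc n) (𝓡 n) (extChartAt (𝓡 n) x₀).symm p v)
      = fderiv ℝ (fun q => f ((extChartAt (𝓡 n) x₀).symm q)) p v := by
  have h := mfderiv_comp_apply_of_eq p (hf.mdifferentiableAt (x := y) (by simp))
    ((contMDiffAt_extChartAt_symm x₀ hp).mdifferentiableAt (by simp)) hy v
  rw [mfderiv_eq_fderiv] at h
  exact h.symm

/-- The differential at `x` in the coordinates of the chart at `x`. -/
theorem mvfderiv_eq_fderiv {f : M → W} (hf : ContMDiff (𝓡 n) 𝓘(ℝ, W) ∞ f) (x : M)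
    (v : TangentSpace (𝓡 n) x) :
    mvfderiv (𝓡 n) f x v = fderiv ℝ (fun q => f ((extChartAt (𝓡 n) x).symm q))
      (extChartAt (𝓡 n) x x) v := by
  have h := mvfderiv_mfderiv_extChartAt_symm hf x (mem_extChartAt_target x)
    (extChartAt_to_inv x) v
  -- At its own base point the inverse of the preferred chart has the identity as differential: this
  -- is the identification of `T_x M` with `ℝⁿ`.
  have e := mfderivWithin_range_extChartAt_symm (I := 𝓡 n) (x := x)
  rw [ModelWithCorners.range_eq_univ, mfderivWithin_univ] at e
  rw [← h, e]
  rfl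

theorem mfderiv_extChartAt_symm_mfderiv (x₀ : M) {p : Euc n}
    (hp : p ∈ (extChartAt (𝓡 n) x₀).target)
    (v : TangentSpace (𝓡 n) ((extChartAt (𝓡 n) x₀).symm p)) :
    mfderiv 𝓘(ℝ, Euc n) (𝓡 n) (extChartAt (𝓡 n) x₀).symm p
      (mfderiv (𝓡 n) 𝓘(ℝ, Euc n) (extChartAt (𝓡 n) x₀) ((extChartAt (𝓡 n) x₀).symm p) v) = v := by
  have e := mfderivWithin_extChartAt_symm_comp_mfderiv_extChartAt (I := 𝓡 n) hp
  rw [ModelWithCorners.range_eq_univ, mfderivWithin_univ] at e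
  exact congrArg (fun L => L v) e

theorem mfderiv_extChartAt_mfderiv_symm (x₀ : M) {p : Euc n}
    (hp : p ∈ (extChartAt (𝓡 n) x₀).target) (v : Euc n) :
    mfderiv (𝓡 n) 𝓘(ℝ, Euc n) (extChartAt (𝓡 n) x₀) ((extChartAt (𝓡 n) x₀).symm p)
      (mfderiv 𝓘(ℝ, Euc n) (𝓡 n) (extChartAt (𝓡 n) x₀).symm p v) = v := by
  have e := mfderiv_extChartAt_comp_mfderivWithin_extChartAt_symm (I := 𝓡 n) hp
  rw [ModelWithCorners.range_eq_univ, mfderivWithin_univ] at e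
  exact congrArg (fun L => L v) e

end Charts

/-! ### Bilinear forms and index raising in one tangent space -/

section Bilinear

variable {n : ℕ} {M : Type*} [TopologicalSpace M] [ChartedSpace (Euc n) M] {x : M}

/-- A function of two tangent vectors is bilinear. -/
def IsBilinear (T : TangentSpace (𝓡 n) x → TangentSpace (𝓡 n) x → ℝ) : Prop :=
  ∃ B : TangentSpace (𝓡 n) x →ₗ[ℝ] TangentSpace (𝓡 n) x →ₗ[ℝ] ℝ, ∀ v w, T v w = B v w

theorem IsBilinear.add {T T' : TangentSpace (𝓡 n) x → TangentSpace (𝓡 n) x → ℝ}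
    (hT : IsBilinear T) (hT' : IsBilinear T') : IsBilinear fun v w => T v w + T' v w := by
  obtain ⟨B, hB⟩ := hT
  obtain ⟨B', hB'⟩ := hT'
  exact ⟨B + B', fun v w => by simp [hB, hB']⟩

theorem IsBilinear.const_mul {T : TangentSpace (𝓡 n) x → TangentSpace (𝓡 n) x → ℝ}
    (hT : IsBilinear T) (c : ℝ) : IsBilinear fun v w => c * T v w := by
  obtain ⟨B, hB⟩ := hT
  exact ⟨c • B, fun v w => by simp [hB]⟩

theorem IsBilinear.sub {T T' : TangentSpace (𝓡 n) x → TangentSpace (𝓡 n) x → ℝ}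
    (hT : IsBilinear T) (hT' : IsBilinear T') : IsBilinear fun v w => T v w - T' v w := by
  obtain ⟨B, hB⟩ := hT
  obtain ⟨B', hB'⟩ := hT'
  exact ⟨B - B', fun v w => by simp [hB, hB']⟩

theorem IsBilinear.flip {T : TangentSpace (𝓡 n) x → TangentSpace (𝓡 n) x → ℝ}
    (hT : IsBilinear T) : IsBilinear fun v w => T w v := by
  obtain ⟨B, hB⟩ := hT
  exact ⟨B.flip, fun v w => by simp [hB]⟩

theorem IsBilinear.sum {ι : Type*} {s : Finset ι}
    {T : ι → TangentSpace (𝓡 n) x → TangentSpace (𝓡 n) x → ℝ}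
    (hT : ∀ i, IsBilinear (T i)) : IsBilinear fun v w => ∑ i ∈ s, T i v w := by
  choose B hB using hT
  exact ⟨∑ i ∈ s, B i, fun v w => by simp [hB, LinearMap.sum_apply]⟩

theorem isBilinear_mul (α β : TangentSpace (𝓡 n) x →ₗ[ℝ] ℝ) :
    IsBilinear fun v w => α v * β w :=
  ⟨(LinearMap.mul ℝ ℝ).compl₁₂ α β, fun v w => by simp⟩

theorem isBilinear_inner {W : Type*} [NormedAddCommGroup W] [InnerProductSpace ℝ W]
    (α β : TangentSpace (𝓡 n) x →ₗ[ℝ] W) : IsBilinear fun v w => ⟪α v, β w⟫_ℝ :=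
  ⟨(innerₗ W).compl₁₂ α β, fun v w => by simp⟩

/-- The components of a tangent vector as a linear map. -/
def compₗ (x : M) (i : Fin n) : TangentSpace (𝓡 n) x →ₗ[ℝ] ℝ where
  toFun v := comp v i
  map_add' _ _ := rfl
  map_smul' _ _ := rfl

theorem eq_sum_comp_frame (v : TangentSpace (𝓡 n) x) : v = ∑ i, comp v i • frame x i := by
  have h := (EuclideanSpace.basisFun (Fin n) ℝ).sum_repr (v : Euc n)
  simp only [EuclideanSpace.basisFun_apply] at h
  exact h.symm

theorem comp_frame (i j : Fin n) : comp (frame x i) j = if j = i then 1 else 0 := by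
  change (EuclideanSpace.single i (1 : ℝ) : Euc n) j = _
  simp

theorem isBilinear_ofComponents (A : Fin n → Fin n → ℝ) :
    IsBilinear (ofComponents (M := M) (x := x) A) := by
  have : IsBilinear fun v w : TangentSpace (𝓡 n) x =>
      ∑ i, ∑ j, A i j * (compₗ x i v * compₗ x j w) :=
    .sum fun i => .sum fun j => (isBilinear_mul _ _).const_mul _
  obtain ⟨B, hB⟩ := this
  refine ⟨B, fun v w => ?_⟩
  rw [← hB]
  unfold ofComponents
  exact Finset.sum_congr rfl fun i _ => Finset.sum_congr rfl fun j _ => mul_assoc _ _ _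

theorem ofComponents_frame (A : Fin n → Fin n → ℝ) (i j : Fin n) :
    ofComponents A (frame x i) (frame x j) = A i j := by
  simp [ofComponents, comp_frame]

theorem IsBilinear.apply_eq {T : TangentSpace (𝓡 n) x → TangentSpace (𝓡 n) x → ℝ}
    (hT : IsBilinear T) (v w : TangentSpace (𝓡 n) x) :
    T v w = ∑ i, ∑ j, comp v i * comp w j * T (frame x i) (frame x j) := by
  obtain ⟨B, hB⟩ := hT
  simp only [hB]
  conv_lhs => rw [eq_sum_comp_frame v, eq_sum_comp_frame w]
  simp only [map_sum, map_smul, LinearMap.sum_apply, LinearMap.smul_apply, smul_eq_mul,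
    Finset.mul_sum]
  rw [Finset.sum_comm]
  exact Finset.sum_congr rfl fun i _ => Finset.sum_congr rfl fun j _ => by ring

/-- Tensors here are plain functions of two vectors; this reduces identities between them to
component identities. -/
theorem IsBilinear.eq_of_frame {T T' : TangentSpace (𝓡 n) x → TangentSpace (𝓡 n) x → ℝ}
    (hT : IsBilinear T) (hT' : IsBilinear T')
    (h : ∀ i j, T (frame x i) (frame x j) = T' (frame x i) (frame x j))
    (v w : TangentSpace (𝓡 n) x) : T v w = T' v w := by
  rw [hT.apply_eq, hT'.apply_eq]
  simp only [h]

theorem isBilinear_square {g T : Tensor2 n M} (hT : IsBilinear (T x)) :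
    IsBilinear (square g T x) := by
  obtain ⟨B, hB⟩ := hT
  have : IsBilinear fun v w : TangentSpace (𝓡 n) x =>
      ∑ k, ∑ l, (gram g x)⁻¹ k l * (B.flip (frame x k) v * B (frame x l) w) :=
    .sum fun i => .sum fun j => (isBilinear_mul _ _).const_mul _
  obtain ⟨B', hB'⟩ := this
  refine ⟨B', fun v w => ?_⟩
  rw [← hB']
  unfold square
  exact Finset.sum_congr rfl fun i _ => Finset.sum_congr rfl fun j _ => by
    simp [hB, mul_assoc]

theorem sharp_spec {g : Tensor2 n M} (hg : IsBilinear (g x)) (hdet : (gram g x).det ≠ 0)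
    (hsymm : ∀ v w, g x v w = g x w v) (α : TangentSpace (𝓡 n) x →ₗ[ℝ] ℝ)
    (w : TangentSpace (𝓡 n) x) : g x (sharp g x α) w = α w := by
  obtain ⟨B, hB⟩ := hg
  have key : ∀ k, B (sharp g x α) (frame x k) = α (frame x k) := by
    intro k
    simp only [sharp, map_sum, map_smul, LinearMap.sum_apply, LinearMap.smul_apply, smul_eq_mul,
      Finset.sum_mul]
    rw [Finset.sum_comm]
    -- The sum runs over the first index of the inverse matrix, so the symmetry of the Gram matrix
    -- is needed.
    have e : ∀ j, ∑ i, (gram g x)⁻¹ i j * gram g x i k = if j = k then 1 else 0 := by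
      intro j
      have ht : (gram g x).transpose = gram g x := by ext a b; exact hsymm _ _
      have h1 := congrFun (congrFun (Matrix.nonsing_inv_mul (gram g x)
        (isUnit_iff_ne_zero.mpr hdet)) j) k
      rw [Matrix.mul_apply, Matrix.one_apply] at h1
      rw [← h1]
      refine Finset.sum_congr rfl fun i _ => ?_
      conv_rhs => rw [← ht, ← Matrix.transpose_nonsing_inv]
      rw [ht]; rfl
    have e' : ∀ j, ∑ i, (gram g x)⁻¹ i j * α (frame x j) * B (frame x i) (frame x k)
        = α (frame x j) * if j = k then 1 else 0 := by
      intro j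
      rw [← e j, Finset.mul_sum]
      refine Finset.sum_congr rfl fun i _ => ?_
      rw [← hB]
      change _ = α (frame x j) * ((gram g x)⁻¹ i j * g x (frame x i) (frame x k))
      ring
    simp [e']
  rw [hB]
  conv_lhs => rw [eq_sum_comp_frame w]
  conv_rhs => rw [eq_sum_comp_frame w]
  simp only [map_sum, map_smul, key]

end Bilinear

/-! ### Independence of the trace from the basis -/

section TraceInvariance

variable {ι : Type*} [Fintype ι] [DecidableEq ι]

/-- The double sum is `tr(G⁻¹ Hᵀ)`, and a change of basis `A` conjugates `G⁻¹ Hᵀ`. Invertibility of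
`A` follows from that of `Aᵀ G A`. -/
theorem sum_inv_mul_congruence (A G H : Matrix ι ι ℝ) (hdet : (A.transpose * G * A).det ≠ 0) :
    ∑ i, ∑ j, (A.transpose * G * A)⁻¹ i j * (A.transpose * H * A) i j
      = ∑ i, ∑ j, G⁻¹ i j * H i j := by
  have hA : IsUnit A.det := by
    rw [isUnit_iff_ne_zero]
    intro h
    simp [Matrix.det_mul, h] at hdet
  have hA' : IsUnit A.transpose.det := by rwa [Matrix.det_transpose]
  have htr : ∀ P Q : Matrix ι ι ℝ, ∑ i, ∑ j, P i j * Q i j = (P * Q.transpose).trace := by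
    intro P Q
    simp [Matrix.trace, Matrix.mul_apply]
  rw [htr, htr, Matrix.mul_inv_rev, Matrix.mul_inv_rev]
  simp only [Matrix.transpose_mul, Matrix.transpose_transpose]
  rw [Matrix.mul_assoc, Matrix.mul_assoc, ← Matrix.mul_assoc A.transpose⁻¹,
    Matrix.nonsing_inv_mul _ hA', Matrix.one_mul, Matrix.trace_mul_comm, Matrix.mul_assoc,
    Matrix.mul_assoc, Matrix.mul_nonsing_inv _ hA, Matrix.mul_one]

end TraceInvariance

/-! ### Locality of Christoffel symbols and curvature -/

section ChristoffelCongr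

variable {n : ℕ} {G G' : Euc n → Matrix (Fin n) (Fin n) ℝ} {S : Set (Euc n)}

theorem christoffel_congr (hS : IsOpen S) (h : ∀ p ∈ S, G p = G' p) {p : Euc n} (hp : p ∈ S)
    (k i j : Fin n) : christoffel G k i j p = christoffel G' k i j p := by
  have e : ∀ i j l, pd i (fun q => G q j l) p = pd i (fun q => G' q j l) p := fun i j l =>
    pd_congr (Filter.eventually_of_mem (hS.mem_nhds hp) fun q hq => by rw [h q hq]) i
  simp only [christoffel, e, h p hp]

/-- Needed because `chartMetric` is identified with `firstForm` only on the chart target; openness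
of that set is what lets derivatives be compared. -/
theorem riemann_congr (hS : IsOpen S) (h : ∀ p ∈ S, G p = G' p) {p : Euc n} (hp : p ∈ S)
    (l i j k : Fin n) : riemann G l i j k p = riemann G' l i j k p := by
  have e : ∀ i l j k, pd i (christoffel G l j k) p = pd i (christoffel G' l j k) p :=
    fun i l j k => pd_congr (Filter.eventually_of_mem (hS.mem_nhds hp)
      fun q hq => christoffel_congr hS h hq l j k) i
  simp only [riemann, e, christoffel_congr hS h hp]

end ChristoffelCongr

/-! ### Global formulas for the hypersurface -/

section Hypersurface

variable {n : ℕ} {M : Type*} [TopologicalSpace M] [ChartedSpace (Euc n) M]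
  {φ : M → USphere n} {N : M → Euc (n + 1 + 1)}

/-- An immersion in the coordinates of the chart at `x₀`. -/
def chartMap (φ : M → USphere n) (x₀ : M) (p : Euc n) : Euc (n + 1 + 1) :=
  (φ ((extChartAt (𝓡 n) x₀).symm p) : Euc (n + 1 + 1))

/-- A vector field along `M` in the coordinates of the chart at `x₀`. -/
def chartNormal (N : M → Euc (n + 1 + 1)) (x₀ : M) (p : Euc n) : Euc (n + 1 + 1) :=
  N ((extChartAt (𝓡 n) x₀).symm p)

theorem IsSmoothImmersion.contMDiff_coe (hφ : IsSmoothImmersion φ) :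
    ContMDiff (𝓡 n) 𝓘(ℝ, Euc (n + 1 + 1)) ∞ (fun y => (φ y : Euc (n + 1 + 1))) :=
  have : Fact (Module.finrank ℝ (Euc (n + 1 + 1)) = n + 1 + 1) := ⟨finrank_euclideanSpace_fin⟩
  (contMDiff_coe_sphere (n := n + 1)).comp hφ.smooth

theorem IsSmoothImmersion.diff_injective (hφ : IsSmoothImmersion φ) (x : M) :
    Function.Injective (diff φ x) := by
  have : Fact (Module.finrank ℝ (Euc (n + 1 + 1)) = n + 1 + 1) := ⟨finrank_euclideanSpace_fin⟩
  have h : ∀ v, diff φ x v = mvfderiv (𝓡 (n + 1))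
      ((↑) : Metric.sphere (0 : Euc (n + 1 + 1)) 1 → Euc (n + 1 + 1)) (φ x)
      (mfderiv (𝓡 n) (𝓡 (n + 1)) φ x v) := fun v =>
    mfderiv_comp_apply_of_eq x
      ((contMDiff_coe_sphere (m := ∞) (n := n + 1) (φ x)).mdifferentiableAt (by simp))
      (hφ.smooth.mdifferentiableAt (by simp)) rfl v
  intro v w hvw
  rw [h, h] at hvw
  exact hφ.injective x (injective_mvfderiv_subtypeVal_sphere (n := n + 1) (φ x) hvw)

/-- The differential of `φ` at `x` as a continuous linear map. -/
def diffₗ (φ : M → USphere n) (x : M) : TangentSpace (𝓡 n) x →L[ℝ] Euc (n + 1 + 1) :=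
  mvfderiv (𝓡 n) (fun y => (φ y : Euc (n + 1 + 1))) x

theorem diffₗ_apply (x : M) (v : TangentSpace (𝓡 n) x) : diffₗ φ x v = diff φ x v := rfl

theorem isBilinear_inducedMetric (x : M) : IsBilinear (inducedMetric φ x) :=
  isBilinear_inner (diffₗ φ x).toLinearMap (diffₗ φ x).toLinearMap

variable [IsManifold (𝓡 n) ∞ M]

theorem diff_coordVec (hφ : IsSmoothImmersion φ) (x₀ : M) {p : Euc n}
    (hp : p ∈ (extChartAt (𝓡 n) x₀).target) (i : Fin n) :
    diff φ ((extChartAt (𝓡 n) x₀).symm p) (coordVec x₀ p i) = vpd i (chartMap φ x₀) p :=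
  mvfderiv_mfderiv_extChartAt_symm hφ.contMDiff_coe x₀ hp rfl _

theorem diff_eq_fderiv (hφ : IsSmoothImmersion φ) (x : M) (v : TangentSpace (𝓡 n) x) :
    diff φ x v = fderiv ℝ (chartMap φ x) (extChartAt (𝓡 n) x x) v :=
  mvfderiv_eq_fderiv hφ.contMDiff_coe x v

theorem diff_frame (hφ : IsSmoothImmersion φ) (x : M) (i : Fin n) :
    diff φ x (frame x i) = vpd i (chartMap φ x) (extChartAt (𝓡 n) x x) :=
  diff_eq_fderiv hφ x _

theorem diff_eq_sum_vpd (hφ : IsSmoothImmersion φ) (x : M) (v : TangentSpace (𝓡 n) x) :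
    diff φ x v = ∑ i, comp v i • vpd i (chartMap φ x) (extChartAt (𝓡 n) x x) :=
  (diff_eq_fderiv hφ x v).trans (fderiv_eq_sum_vpd _ _ _)

theorem diff_eq_fderiv_chartField (hφ : IsSmoothImmersion φ) (U : VField n M) (x₀ : M) {p : Euc n}
    (hp : p ∈ (extChartAt (𝓡 n) x₀).target) :
    diff φ ((extChartAt (𝓡 n) x₀).symm p) (U ((extChartAt (𝓡 n) x₀).symm p))
      = fderiv ℝ (chartMap φ x₀) p (chartField U x₀ p) :=
  (congrArg (diff φ _) (mfderiv_extChartAt_symm_mfderiv x₀ hp (U _))).symm.trans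
    (mvfderiv_mfderiv_extChartAt_symm hφ.contMDiff_coe x₀ hp rfl _)

/-- The coordinate representation of a hypersurface of the sphere. -/
theorem isLocalHypersurface (hφ : IsSmoothImmersion φ) (hN : IsUnitNormal φ N) (x₀ : M) :
    IsLocalHypersurface (extChartAt (𝓡 n) x₀).target (chartMap φ x₀) (chartNormal N x₀) where
  isOpen := isOpen_extChartAt_target x₀
  smooth p hp := contDiffAt_comp_extChartAt_symm hφ.contMDiff_coe x₀ hp
  smooth_normal p hp := contDiffAt_comp_extChartAt_symm hN.smooth x₀ hp
  unit p _ := by simp [chartMap]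
  unit_normal p _ := by simp [chartNormal, hN.norm_eq_one]
  normal_position p _ := hN.tangent_sphere _
  normal_tangent p hp i := by
    rw [← diff_coordVec hφ x₀ hp]; exact hN.normal _ _
  injective p hp v w hvw := by
    have h := fun v => mvfderiv_mfderiv_extChartAt_symm hφ.contMDiff_coe x₀ hp rfl v
    have hvw' : mfderiv 𝓘(ℝ, Euc n) (𝓡 n) (extChartAt (𝓡 n) x₀).symm p v
        = mfderiv 𝓘(ℝ, Euc n) (𝓡 n) (extChartAt (𝓡 n) x₀).symm p w :=
      hφ.diff_injective _ (((h v).trans hvw).trans (h w).symm)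
    rw [← mfderiv_extChartAt_mfderiv_symm x₀ hp v, hvw', mfderiv_extChartAt_mfderiv_symm x₀ hp w]

theorem inner_position_diff (hφ : IsSmoothImmersion φ) (hN : IsUnitNormal φ N) (x : M)
    (v : TangentSpace (𝓡 n) x) : ⟪(φ x : Euc (n + 1 + 1)), diff φ x v⟫_ℝ = 0 := by
  have h := (isLocalHypersurface hφ hN x).inner_position_vpd (mem_extChartAt_target x)
  rw [diff_eq_sum_vpd hφ, inner_sum]
  refine Finset.sum_eq_zero fun i _ => ?_
  have hi := h i
  rw [chartMap, extChartAt_to_inv] at hi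
  rw [inner_smul_right, hi, mul_zero]

/-- The radial correction in the connection of the sphere is a multiple of `φ x`, which is
orthogonal to the image of `dφ`. -/
theorem secondFund_eq (hφ : IsSmoothImmersion φ) (hN : IsUnitNormal φ N) (x : M)
    (v w : TangentSpace (𝓡 n) x) :
    secondFund φ N x v w = -⟪mvfderiv (𝓡 n) N x v, diff φ x w⟫_ℝ := by
  simp [secondFund, sphereCov, inner_sub_left, inner_smul_left, inner_position_diff hφ hN]

theorem secondFund_coordVec (hφ : IsSmoothImmersion φ) (hN : IsUnitNormal φ N) (x₀ : M) {p : Euc n}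
    (hp : p ∈ (extChartAt (𝓡 n) x₀).target) (i j : Fin n) :
    secondFund φ N ((extChartAt (𝓡 n) x₀).symm p) (coordVec x₀ p i) (coordVec x₀ p j)
      = secondForm (chartMap φ x₀) (chartNormal N x₀) p i j := by
  rw [secondFund_eq hφ hN, diff_coordVec hφ x₀ hp, secondForm_apply]
  rw [show vpd i (chartNormal N x₀) p = _ from
    (mvfderiv_mfderiv_extChartAt_symm hN.smooth x₀ hp rfl _).symm]
  rfl

theorem gram_inducedMetric (hφ : IsSmoothImmersion φ) (x : M) :
    gram (inducedMetric φ) x = firstForm (chartMap φ x) (extChartAt (𝓡 n) x x) := by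
  ext i j
  simp [gram, inducedMetric, diff_frame hφ, firstForm_apply]

theorem gram_secondFund (hφ : IsSmoothImmersion φ) (hN : IsUnitNormal φ N) (x : M) :
    gram (secondFund φ N) x
      = secondForm (chartMap φ x) (chartNormal N x) (extChartAt (𝓡 n) x x) := by
  ext i j
  simp only [gram, Matrix.of_apply, secondFund_eq hφ hN, diff_frame hφ, secondForm_apply]
  rw [show mvfderiv (𝓡 n) N x (frame x i) = _ from mvfderiv_eq_fderiv hN.smooth x _]
  rfl

theorem chartMetric_inducedMetric (hφ : IsSmoothImmersion φ) (x₀ : M) {p : Euc n}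
    (hp : p ∈ (extChartAt (𝓡 n) x₀).target) :
    chartMetric (inducedMetric φ) x₀ p = firstForm (chartMap φ x₀) p := by
  ext i j
  rw [chartMetric, Matrix.of_apply, inducedMetric, diff_coordVec hφ x₀ hp,
    diff_coordVec hφ x₀ hp, firstForm_apply]

theorem isBilinear_secondFund (hφ : IsSmoothImmersion φ) (hN : IsUnitNormal φ N) (x : M) :
    IsBilinear (secondFund φ N x) := by
  have := isBilinear_inner (-(mvfderiv (𝓡 n) N x)).toLinearMap (diffₗ φ x).toLinearMap
  convert this using 3 with v w
  rw [secondFund_eq hφ hN]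
  simp [diffₗ_apply]

theorem det_gram_ne_zero (hφ : IsSmoothImmersion φ) (hN : IsUnitNormal φ N) (x : M) :
    (gram (inducedMetric φ) x).det ≠ 0 := by
  rw [gram_inducedMetric hφ]
  exact (isLocalHypersurface hφ hN x).det_ne_zero (mem_extChartAt_target x)

/-- The radial part removed from `V` is orthogonal to the image of `dφ`, so `V` itself may stand on
the right. -/
theorem inducedMetric_tangentPart (hφ : IsSmoothImmersion φ) (hN : IsUnitNormal φ N)
    (V : Euc (n + 1 + 1) → Euc (n + 1 + 1)) (x : M) (w : TangentSpace (𝓡 n) x) :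
    inducedMetric φ x (tangentPart φ (tangentSphere V) x) w = ⟪V (φ x), diff φ x w⟫_ℝ := by
  have h := sharp_spec (isBilinear_inducedMetric x) (det_gram_ne_zero hφ hN x)
    (fun v w => real_inner_comm _ _)
    ((innerₗ _ (tangentSphere V (φ x))) ∘ₗ (diffₗ φ x).toLinearMap) w
  refine h.trans ?_
  change ⟪tangentSphere V (φ x), diff φ x w⟫_ℝ = _
  simp [tangentSphere, inner_sub_left, inner_smul_left, inner_position_diff hφ hN]

theorem sum_firstForm_chartField (hφ : IsSmoothImmersion φ) (hN : IsUnitNormal φ N)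
    (V : Euc (n + 1 + 1) → Euc (n + 1 + 1)) (x₀ : M) {p : Euc n}
    (hp : p ∈ (extChartAt (𝓡 n) x₀).target) (j : Fin n) :
    ∑ k, firstForm (chartMap φ x₀) p k j
        * chartField (tangentPart φ (tangentSphere V)) x₀ p k
      = ⟪V (chartMap φ x₀ p), vpd j (chartMap φ x₀) p⟫_ℝ := by
  have h := inducedMetric_tangentPart hφ hN V ((extChartAt (𝓡 n) x₀).symm p) (coordVec x₀ p j)
  rw [inducedMetric, diff_coordVec hφ x₀ hp, diff_eq_fderiv_chartField hφ _ x₀ hp,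
    fderiv_eq_sum_vpd, sum_inner] at h
  refine Eq.trans ?_ h
  refine Finset.sum_congr rfl fun k _ => ?_
  rw [inner_smul_left, firstForm_apply, RCLike.conj_to_real, mul_comm]

/-- Solving the system of `sum_firstForm_chartField` gives `U^i = g^{ij} ⟨V, ∂_j F⟩`, a smooth
expression. -/
theorem contDiffAt_chartField (hφ : IsSmoothImmersion φ) (hN : IsUnitNormal φ N)
    {V : Euc (n + 1 + 1) → Euc (n + 1 + 1)} (hV : ContDiff ℝ ∞ V) (x₀ : M) {p : Euc n}
    (hp : p ∈ (extChartAt (𝓡 n) x₀).target) (i : Fin n) :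
    ContDiffAt ℝ ∞ (fun q => chartField (tangentPart φ (tangentSphere V)) x₀ q i) p := by
  have hl := isLocalHypersurface hφ hN x₀
  have h : ContDiffAt ℝ ∞ (fun q => ∑ j, (firstForm (chartMap φ x₀) q)⁻¹ i j
      * ⟪V (chartMap φ x₀ q), vpd j (chartMap φ x₀) q⟫_ℝ) p :=
    ContDiffAt.sum fun j _ => (hl.contDiffAt_inv_firstForm hp i j).mul
      ((hV.contDiffAt.comp p (hl.smooth p hp)).inner ℝ (contDiffAt_vpd (hl.smooth p hp) j))
  refine h.congr_of_eventuallyEq (Filter.eventually_of_mem (hl.mem_nhds hp) fun q hq => ?_)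
  simp only [← sum_firstForm_chartField hφ hN V x₀ hq, Finset.mul_sum]
  rw [Finset.sum_comm]
  have e : ∀ k, ∑ j, (firstForm (chartMap φ x₀) q)⁻¹ i j * (firstForm (chartMap φ x₀) q k j
      * chartField (tangentPart φ (tangentSphere V)) x₀ q k)
      = (if i = k then 1 else 0) * chartField (tangentPart φ (tangentSphere V)) x₀ q k := by
    intro k
    rw [← hl.inv_mul hq i k, Finset.sum_mul]
    exact Finset.sum_congr rfl fun j _ => by rw [firstForm_symm k j]; ring
  simp [e]

/-- The tangent bundle trivialization at `x₀` is the differential of the chart, so in it the section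
is `chartField`. -/
theorem smoothVField_tangentPart (hφ : IsSmoothImmersion φ) (hN : IsUnitNormal φ N)
    {V : Euc (n + 1 + 1) → Euc (n + 1 + 1)} (hV : ContDiff ℝ ∞ V) :
    SmoothVField (tangentPart φ (tangentSphere V)) := by
  intro x₀
  refine (Bundle.contMDiffAt_section x₀).mpr ?_
  have hs : ContDiffAt ℝ ∞ (fun q => chartField (tangentPart φ (tangentSphere V)) x₀ q)
      (extChartAt (𝓡 n) x₀ x₀) :=
    contDiffAt_euclidean.mpr fun i =>
      contDiffAt_chartField hφ hN hV x₀ (mem_extChartAt_target x₀) i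
  refine contMDiffAt_of_comp_extChartAt x₀ hs fun p hp => ?_
  have hy : (extChartAt (𝓡 n) x₀).symm p ∈ (chartAt (Euc n) x₀).source := by
    rw [← extChartAt_source (𝓡 n)]; exact (extChartAt (𝓡 n) x₀).map_target hp
  have := TangentBundle.continuousLinearMapAt_trivializationAt (I := 𝓡 n) hy
  refine Eq.trans ?_ (congrArg (fun L => L (tangentPart φ (tangentSphere V) _)) this)
  simp only [Bundle.Trivialization.continuousLinearMapAt_apply,
    Bundle.Trivialization.linearMapAt_apply]
  rw [if_pos (by simpa using hy)]

/-- Both sides are bilinear, so it suffices to compare them on the coordinate basis at the base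
point, where `lie_eq` applies. -/
theorem lieDeriv_eq (hφ : IsSmoothImmersion φ) (hN : IsUnitNormal φ N)
    {V : Euc (n + 1 + 1) → Euc (n + 1 + 1)} {a : Euc (n + 1 + 1) → ℝ}
    {ψ : Euc (n + 1 + 1) → (Euc (n + 1 + 1) →L[ℝ] ℝ)} (hV : IsTorseForming V a ψ)
    (x : M) (X Y : TangentSpace (𝓡 n) x) :
    lieDeriv (tangentPart φ (tangentSphere V)) (inducedMetric φ) x X Y
      = 2 * (a (φ x) - ⟪V (φ x), (φ x : Euc (n + 1 + 1))⟫_ℝ) * inducedMetric φ x X Y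
        + 2 * ⟪V (φ x), N x⟫_ℝ * secondFund φ N x X Y
        + ψ (φ x) (diff φ x X) * ⟪V (φ x), diff φ x Y⟫_ℝ
        + ψ (φ x) (diff φ x Y) * ⟪V (φ x), diff φ x X⟫_ℝ := by
  have hψ : IsBilinear fun X Y : TangentSpace (𝓡 n) x =>
      ψ (φ x) (diff φ x X) * ⟪V (φ x), diff φ x Y⟫_ℝ :=
    isBilinear_mul ((ψ (φ x)).toLinearMap ∘ₗ (diffₗ φ x).toLinearMap)
      ((innerₗ _ (V (φ x))) ∘ₗ (diffₗ φ x).toLinearMap)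
  refine IsBilinear.eq_of_frame (T' := fun X Y => _) (isBilinear_ofComponents _)
    (((((isBilinear_inducedMetric x).const_mul _).add
      ((isBilinear_secondFund hφ hN x).const_mul _)).add hψ).add hψ.flip) (fun i j => ?_) X Y
  have hl := isLocalHypersurface hφ hN x
  have hp := mem_extChartAt_target (I := 𝓡 n) x
  rw [ofComponents_frame]
  have h := hl.lie_eq hp hV
    (fun k => (contDiffAt_chartField hφ hN hV.smooth_field x hp k).differentiableAt (by simp))
    (fun q hq j => sum_firstForm_chartField hφ hN V x hq j) i j
  have hF : chartMap φ x (extChartAt (𝓡 n) x x) = φ x := by simp [chartMap]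
  have hν : chartNormal N x (extChartAt (𝓡 n) x x) = N x := by simp [chartNormal]
  have hG : inducedMetric φ x (frame x i) (frame x j) = _ :=
    congrFun (congrFun (gram_inducedMetric hφ x) i) j
  have hH : secondFund φ N x (frame x i) (frame x j) = _ :=
    congrFun (congrFun (gram_secondFund hφ hN x) i) j
  rw [hG, hH, diff_frame hφ, diff_frame hφ]
  rw [hF, hν] at h
  rw [← h]
  refine Finset.sum_congr rfl fun k _ => ?_
  rw [chartMetric_inducedMetric hφ x hp, pd_congr (Filter.eventually_of_mem (hl.mem_nhds hp)
    fun q hq => by rw [chartMetric_inducedMetric hφ x hq])]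

theorem Ric_eq (hφ : IsSmoothImmersion φ) (hN : IsUnitNormal φ N)
    (x : M) (X Y : TangentSpace (𝓡 n) x) :
    Ric (inducedMetric φ) x X Y
      = trace (inducedMetric φ) (secondFund φ N) x * secondFund φ N x X Y
        - square (inducedMetric φ) (secondFund φ N) x X Y
        + ((n : ℝ) - 1) * inducedMetric φ x X Y := by
  refine IsBilinear.eq_of_frame (T' := fun X Y => _) (isBilinear_ofComponents _)
    ((((isBilinear_secondFund hφ hN x).const_mul _).sub
      (isBilinear_square (isBilinear_secondFund hφ hN x))).add
      ((isBilinear_inducedMetric x).const_mul _)) (fun i j => ?_) X Y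
  have hl := isLocalHypersurface hφ hN x
  have hp := mem_extChartAt_target (I := 𝓡 n) x
  rw [ofComponents_frame]
  have h := hl.ricci_eq hp i j
  rw [← gram_inducedMetric hφ, ← gram_secondFund hφ hN] at h
  refine Eq.trans (Finset.sum_congr rfl fun k _ => ?_) h
  exact riemann_congr hl.isOpen (fun p hp => chartMetric_inducedMetric hφ x hp) hp k k i j

theorem trace_metric (hφ : IsSmoothImmersion φ) (hN : IsUnitNormal φ N) (x : M) :
    trace (inducedMetric φ) (inducedMetric φ) x = n := by
  have hl := isLocalHypersurface hφ hN x
  have h := fun i => hl.inv_mul (mem_extChartAt_target (I := 𝓡 n) x) i i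
  simp only [if_true] at h
  unfold trace
  rw [gram_inducedMetric hφ]
  have h' : ∀ i, ∑ j, (firstForm (chartMap φ x) (extChartAt (𝓡 n) x x))⁻¹ i j
      * firstForm (chartMap φ x) (extChartAt (𝓡 n) x x) i j = 1 := fun i => by
    rw [← h i]
    exact Finset.sum_congr rfl fun j _ => by rw [firstForm_symm i j]
  simp only [h']
  simp

theorem scal_eq (hφ : IsSmoothImmersion φ) (hN : IsUnitNormal φ N) (x : M) :
    scal (inducedMetric φ) x = (n : ℝ) * ((n : ℝ) - 1)
      + trace (inducedMetric φ) (secondFund φ N) x ^ 2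
      - trace (inducedMetric φ) (square (inducedMetric φ) (secondFund φ N)) x := by
  have e : ∀ i j, gram (Ric (inducedMetric φ)) x i j
      = trace (inducedMetric φ) (secondFund φ N) x * gram (secondFund φ N) x i j
        - gram (square (inducedMetric φ) (secondFund φ N)) x i j
        + ((n : ℝ) - 1) * gram (inducedMetric φ) x i j := fun i j => Ric_eq hφ hN x _ _
  have h1 := trace_metric hφ hN x
  unfold scal
  rw [trace]
  simp only [e, mul_add, mul_sub, Finset.sum_add_distrib, Finset.sum_sub_distrib,
    mul_left_comm _ (trace _ _ x), mul_left_comm _ ((n : ℝ) - 1), ← Finset.mul_sum]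
  rw [← trace, ← trace, ← trace, h1]
  ring

end Hypersurface

/-! ### Smoothness of tensor fields from their coordinate components -/

section SmoothForms

theorem contDiffAt_sum_smul {E G ι : Type*} [NormedAddCommGroup E] [NormedSpace ℝ E]
    [NormedAddCommGroup G] [NormedSpace ℝ G] [Fintype ι] {t : ι → ι → E → ℝ} (C : ι → ι → G) {x : E}
    (ht : ∀ i j, ContDiffAt ℝ ∞ (t i j) x) :
    ContDiffAt ℝ ∞ (fun p => ∑ i, ∑ j, t i j p • C i j) x :=
  ContDiffAt.sum fun i _ => ContDiffAt.sum fun j _ => (ht i j).smul contDiffAt_const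

variable {n : ℕ} {M : Type*} [TopologicalSpace M] [ChartedSpace (Euc n) M] [IsManifold (𝓡 n) ∞ M]

theorem symmL_trivializationAt_extChartAt_symm (x₀ : M) {p : Euc n}
    (hp : p ∈ (extChartAt (𝓡 n) x₀).target) (v : Euc n) :
    (trivializationAt (Euc n) (TangentSpace (𝓡 n) (M := M)) x₀).symmL ℝ
        ((extChartAt (𝓡 n) x₀).symm p) v
      = mfderiv 𝓘(ℝ, Euc n) (𝓡 n) (extChartAt (𝓡 n) x₀).symm p v := by
  have hy : (extChartAt (𝓡 n) x₀).symm p ∈ (chartAt (Euc n) x₀).source := by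
    rw [← extChartAt_source (𝓡 n)]; exact (extChartAt (𝓡 n) x₀).map_target hp
  have h := TangentBundle.symmL_trivializationAt (I := 𝓡 n) hy
  rw [ModelWithCorners.range_eq_univ, mfderivWithin_univ, (extChartAt (𝓡 n) x₀).right_inv hp] at h
  exact congrArg (fun L => L v) h

theorem smoothForm2_of_coordVec (T : Form2 n M)
    (hT : ∀ x₀ : M, ∀ i j, ∃ t : Euc n → ℝ, ContDiffAt ℝ ∞ t (extChartAt (𝓡 n) x₀ x₀) ∧
      ∀ p ∈ (extChartAt (𝓡 n) x₀).target,
        T ((extChartAt (𝓡 n) x₀).symm p) (coordVec x₀ p i) (coordVec x₀ p j) = t p) :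
    SmoothForm2 T := by
  intro x₀
  refine (contMDiffAt_hom_bundle _).mpr ⟨contMDiffAt_id, ?_⟩
  choose t ht hTt using hT x₀
  -- `C i j` is the constant form `dxⁱ ⊗ dxʲ`.
  let C : Fin n → Fin n → (Euc n →L[ℝ] Euc n →L[ℝ] ℝ) := fun i j =>
    (EuclideanSpace.proj i : Euc n →L[ℝ] ℝ).smulRight (EuclideanSpace.proj j : Euc n →L[ℝ] ℝ)
  have hs : ContDiffAt ℝ ∞ (fun p => ∑ i, ∑ j, t i j p • C i j) (extChartAt (𝓡 n) x₀ x₀) :=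
    contDiffAt_sum_smul C ht
  refine contMDiffAt_of_comp_extChartAt x₀ hs fun p hp => ?_
  have hy : (extChartAt (𝓡 n) x₀).symm p ∈ (chartAt (Euc n) x₀).source := by
    rw [← extChartAt_source (𝓡 n)]; exact (extChartAt (𝓡 n) x₀).map_target hp
  have hframe : ∀ i, coordVec x₀ p i = (trivializationAt (Euc n)
      (TangentSpace (𝓡 n) (M := M)) x₀).symmL ℝ ((extChartAt (𝓡 n) x₀).symm p)
        (EuclideanSpace.single i 1) := fun i =>
    (symmL_trivializationAt_extChartAt_symm x₀ hp _).symm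
  have hb : ∀ i, (EuclideanSpace.basisFun (Fin n) ℝ).toBasis i = EuclideanSpace.single i 1 := by
    simp
  refine ContinuousLinearMap.coe_injective
    ((EuclideanSpace.basisFun (Fin n) ℝ).toBasis.ext fun i => ?_)
  refine ContinuousLinearMap.coe_injective
    ((EuclideanSpace.basisFun (Fin n) ℝ).toBasis.ext fun j => ?_)
  rw [hb, hb]
  trans t i j p
  -- In the trivialization, evaluating on standard basis vectors amounts to evaluating `T` on the
  -- coordinate fields `coordVec`.
  · rw [← hTt i j p hp, hframe, hframe]
    have hy' : (extChartAt (𝓡 n) x₀).symm p ∈ (trivializationAt (Euc n →L[ℝ] ℝ)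
        (fun b : M => TangentSpace (𝓡 n) b →L[ℝ] ℝ) x₀).baseSet := by
      simpa [hom_trivializationAt_baseSet] using hy
    simp only [ContinuousLinearMap.inCoordinates, ContinuousLinearMap.coe_coe,
      ContinuousLinearMap.comp_apply, Bundle.Trivialization.continuousLinearMapAt_apply,
      Bundle.Trivialization.linearMapAt_apply, if_pos hy', hom_trivializationAt_apply]
    simp
  · simp [C]

end SmoothForms

/-! ### The trace-free part of the second fundamental form -/

section Hypersurface

variable {n : ℕ} {M : Type*} [TopologicalSpace M] [ChartedSpace (Euc n) M] [IsManifold (𝓡 n) ∞ M]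
  {φ : M → USphere n} {N : M → Euc (n + 1 + 1)}

/-- `trace` uses at each point the basis of that point's own preferred chart, which may vary without
continuity. Smoothness requires rewriting it in the one fixed chart at `x₀`. -/
theorem trace_secondFund_extChartAt_symm (hφ : IsSmoothImmersion φ) (hN : IsUnitNormal φ N) (x₀ : M)
    {p : Euc n} (hp : p ∈ (extChartAt (𝓡 n) x₀).target) :
    trace (inducedMetric φ) (secondFund φ N) ((extChartAt (𝓡 n) x₀).symm p)
      = ∑ i, ∑ j, (firstForm (chartMap φ x₀) p)⁻¹ i j
        * secondForm (chartMap φ x₀) (chartNormal N x₀) p i j := by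
  -- The change of basis from `frame` to the coordinate fields of the chart at `x₀`.
  let A : Matrix (Fin n) (Fin n) ℝ := Matrix.of fun k i => comp (coordVec x₀ p i) k
  have hA : ∀ T : Tensor2 n M, IsBilinear (T ((extChartAt (𝓡 n) x₀).symm p)) → ∀ i j,
      T ((extChartAt (𝓡 n) x₀).symm p) (coordVec x₀ p i) (coordVec x₀ p j)
        = (A.transpose * gram T ((extChartAt (𝓡 n) x₀).symm p) * A) i j := by
    intro T hT i j
    rw [hT.apply_eq, Finset.sum_comm]
    simp only [Matrix.mul_apply, Finset.sum_mul]
    exact Finset.sum_congr rfl fun l _ => Finset.sum_congr rfl fun k _ => by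
      simp only [A, gram, Matrix.transpose_apply, Matrix.of_apply]; ring
  have hG : firstForm (chartMap φ x₀) p
      = A.transpose * gram (inducedMetric φ) ((extChartAt (𝓡 n) x₀).symm p) * A := by
    ext i j
    rw [← hA _ (isBilinear_inducedMetric _), ← chartMetric_inducedMetric hφ x₀ hp]
    rfl
  have hH : secondForm (chartMap φ x₀) (chartNormal N x₀) p
      = A.transpose * gram (secondFund φ N) ((extChartAt (𝓡 n) x₀).symm p) * A := by
    ext i j
    rw [← hA _ (isBilinear_secondFund hφ hN _), secondFund_coordVec hφ hN x₀ hp]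
  have hdet := (isLocalHypersurface hφ hN x₀).det_ne_zero hp
  rw [hG] at hdet
  rw [hG, hH, sum_inv_mul_congruence _ _ _ hdet]
  rfl

theorem contDiffAt_trace (hφ : IsSmoothImmersion φ) (hN : IsUnitNormal φ N) (x₀ : M)
    {p : Euc n} (hp : p ∈ (extChartAt (𝓡 n) x₀).target) :
    ContDiffAt ℝ ∞ (fun q => ∑ i, ∑ j, (firstForm (chartMap φ x₀) q)⁻¹ i j
        * secondForm (chartMap φ x₀) (chartNormal N x₀) q i j) p :=
  ContDiffAt.sum fun i _ => ContDiffAt.sum fun j _ =>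
    ((isLocalHypersurface hφ hN x₀).contDiffAt_inv_firstForm hp i j).mul
      ((isLocalHypersurface hφ hN x₀).contDiffAt_secondForm hp i j)

theorem smoothFun_trace (hφ : IsSmoothImmersion φ) (hN : IsUnitNormal φ N) :
    SmoothFun (n := n) (trace (inducedMetric φ) (secondFund φ N)) := fun x₀ =>
  contMDiffAt_of_comp_extChartAt x₀ (contDiffAt_trace hφ hN x₀ (mem_extChartAt_target x₀))
    fun _ hp => trace_secondFund_extChartAt_symm hφ hN x₀ hp

/-- The trace-free part `H - (tr H / n) g` of the second fundamental tensor field. -/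
def traceFreePart (φ : M → USphere n) (N : M → Euc (n + 1 + 1)) : Form2 n M := fun x =>
  ((innerSL ℝ).bilinearComp (-mvfderiv (𝓡 n) N x : Euc n →L[ℝ] Euc (n + 1 + 1))
      (diffₗ φ x : Euc n →L[ℝ] Euc (n + 1 + 1))
    - (trace (inducedMetric φ) (secondFund φ N) x / n) •
      (innerSL ℝ).bilinearComp (diffₗ φ x : Euc n →L[ℝ] Euc (n + 1 + 1))
        (diffₗ φ x : Euc n →L[ℝ] Euc (n + 1 + 1)) : Euc n →L[ℝ] Euc n →L[ℝ] ℝ)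

theorem traceFreePart_apply (hφ : IsSmoothImmersion φ) (hN : IsUnitNormal φ N) (x : M)
    (X Y : TangentSpace (𝓡 n) x) :
    traceFreePart φ N x X Y = secondFund φ N x X Y
      - trace (inducedMetric φ) (secondFund φ N) x / n * inducedMetric φ x X Y := by
  rw [secondFund_eq hφ hN, ← inner_neg_left]
  rfl

theorem secondFund_symm (hφ : IsSmoothImmersion φ) (hN : IsUnitNormal φ N) (x : M)
    (X Y : TangentSpace (𝓡 n) x) : secondFund φ N x X Y = secondFund φ N x Y X := by
  refine (isBilinear_secondFund hφ hN x).eq_of_frame (isBilinear_secondFund hφ hN x).flip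
    (fun i j => ?_) X Y
  have h := (isLocalHypersurface hφ hN x).secondForm_symm (mem_extChartAt_target x) i j
  rw [← gram_secondFund hφ hN] at h
  exact h

theorem smoothForm2_traceFreePart (hφ : IsSmoothImmersion φ) (hN : IsUnitNormal φ N) :
    SmoothForm2 (traceFreePart φ N) := by
  refine smoothForm2_of_coordVec _ fun x₀ i j => ?_
  have hl := isLocalHypersurface hφ hN x₀
  have hp₀ := mem_extChartAt_target (I := 𝓡 n) x₀
  refine ⟨_, (hl.contDiffAt_secondForm hp₀ i j).sub
    (((contDiffAt_trace hφ hN x₀ hp₀).div_const (n : ℝ)).mul (hl.contDiffAt_firstForm hp₀ i j)),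
    fun p hp => ?_⟩
  rw [traceFreePart_apply hφ hN, secondFund_coordVec hφ hN x₀ hp,
    trace_secondFund_extChartAt_symm hφ hN x₀ hp, ← chartMetric_inducedMetric hφ x₀ hp]
  rfl

theorem trace_traceFreePart (hφ : IsSmoothImmersion φ) (hN : IsUnitNormal φ N) (x : M) :
    trace (inducedMetric φ) (fun y X Y => traceFreePart φ N y X Y) x = 0 := by
  -- In dimension zero `tr(H)/n` is a division by zero, but the trace is an empty sum.
  rcases Nat.eq_zero_or_pos n with rfl | hn
  · simp [trace]
  have e : ∀ i j, gram (fun y X Y => traceFreePart φ N y X Y) x i j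
      = gram (secondFund φ N) x i j
        - trace (inducedMetric φ) (secondFund φ N) x / n * gram (inducedMetric φ) x i j :=
    fun i j => traceFreePart_apply hφ hN x _ _
  have h1 := trace_metric hφ hN x
  have hn' : (n : ℝ) ≠ 0 := by positivity
  rw [trace]
  simp only [e, mul_sub, Finset.sum_sub_distrib, mul_left_comm _ (_ / (n : ℝ)), ← Finset.mul_sum]
  rw [← trace, ← trace, h1]
  field_simp
  ring

theorem isPseudoQuasiUmbilical (hφ : IsSmoothImmersion φ) (hN : IsUnitNormal φ N) :
    IsPseudoQuasiUmbilical (inducedMetric φ) (secondFund φ N) := by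
  refine ⟨fun x => trace (inducedMetric φ) (secondFund φ N) x / n, fun _ => 0, fun _ => 0,
    traceFreePart φ N, ?_, contMDiff_const, ?_, smoothForm2_traceFreePart hφ hN, ?_,
    trace_traceFreePart hφ hN, ?_⟩
  · exact (smoothFun_trace hφ hN).div_const (n : ℝ)
  · exact Bundle.contMDiff_zeroSection ℝ _
  · intro x X Y
    rw [traceFreePart_apply hφ hN, traceFreePart_apply hφ hN, secondFund_symm hφ hN,
      inducedMetric, inducedMetric, real_inner_comm]
  · intro x X Y
    rw [traceFreePart_apply hφ hN]
    ring

end Hypersurface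

end

end SphereSoliton

/-! ### The soliton equivalences -/

theorem mainTheorem3 {n : ℕ} {M : Type*} [TopologicalSpace M]
    [ChartedSpace (SphereSoliton.Euc n) M] [IsManifold (𝓡 n) ∞ M]
    -- an orientable hypersurface of the unit sphere, with its unit normal field
    (φ : M → SphereSoliton.USphere n) (hφ : SphereSoliton.IsSmoothImmersion φ)
    (N : M → SphereSoliton.Euc (n + 1 + 1)) (hN : SphereSoliton.IsUnitNormal φ N)
    -- a torse-forming vector field on the Euclidean space
    (V : SphereSoliton.Euc (n + 1 + 1) → SphereSoliton.Euc (n + 1 + 1))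
    (a : SphereSoliton.Euc (n + 1 + 1) → ℝ)
    (ψ : SphereSoliton.Euc (n + 1 + 1) → (SphereSoliton.Euc (n + 1 + 1) →L[ℝ] ℝ))
    (hV : SphereSoliton.IsTorseForming V a ψ)
    -- the induced metric, the second fundamental tensor field and its trace
    (g H : SphereSoliton.Tensor2 n M) (trH : M → ℝ)
    (hg : g = SphereSoliton.inducedMetric φ)
    (hH : H = SphereSoliton.secondFund φ N)
    (htrH : trH = SphereSoliton.trace g H)
    -- the components of `V` along the hypersurface; the normal of the sphere at `p` is `p`
    (U : SphereSoliton.VField n M) (δ ϱ : M → ℝ)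
    (hU : U = SphereSoliton.tangentPart φ (SphereSoliton.tangentSphere V))
    (hδ : ∀ x, δ x = ⟪V (φ x), N x⟫_ℝ)
    (hϱ : ∀ x, ϱ x = ⟪V (φ x), (φ x : SphereSoliton.Euc (n + 1 + 1))⟫_ℝ)
    -- the data of the soliton
    (η : SphereSoliton.Form1 n M) (hη : SphereSoliton.SmoothForm1 η)
    (lam mu : M → ℝ) (hlam : SphereSoliton.SmoothFun (n := n) lam)
    (hmu : SphereSoliton.SmoothFun (n := n) mu) :
    (SphereSoliton.IsAlmostEtaRicciSoliton g η U lam mu ↔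
      ∀ (x : M) (X Y : TangentSpace (𝓡 n) x),
        SphereSoliton.square g H x X Y
          = (trH x + δ x) * H x X Y + ((n : ℝ) - 1 - ϱ x - lam x + a (φ x)) * g x X Y
            - mu x * (η x X * η x Y)
            + 1 / 2 * (ψ (φ x) (SphereSoliton.diff φ x X) * g x (U x) Y
                + ψ (φ x) (SphereSoliton.diff φ x Y) * g x (U x) X)) ∧
    (SphereSoliton.IsAlmostEtaYamabeSoliton g η U lam mu ↔
      ∀ (x : M) (X Y : TangentSpace (𝓡 n) x),
        δ x * H x X Y
          = ((n : ℝ) * ((n : ℝ) - 1) + trH x ^ 2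
                - SphereSoliton.trace g (SphereSoliton.square g H) x
                + ϱ x - lam x - a (φ x)) * g x X Y
            + mu x * (η x X * η x Y)
            - 1 / 2 * (ψ (φ x) (SphereSoliton.diff φ x X) * g x (U x) Y
                + ψ (φ x) (SphereSoliton.diff φ x Y) * g x (U x) X)) ∧
    (SphereSoliton.IsAlmostEtaYamabeSoliton g η U lam mu →
      SphereSoliton.IsPseudoQuasiUmbilical g H) := by
  subst hg hH htrH hU
  obtain rfl : δ = fun x => ⟪V (φ x), N x⟫_ℝ := funext hδ
  obtain rfl : ϱ = fun x => ⟪V (φ x), (φ x : SphereSoliton.Euc (n + 1 + 1))⟫_ℝ := funext hϱ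
  -- The soliton structures include smoothness of `U`, which the displayed equations do not supply.
  have hUs := SphereSoliton.smoothVField_tangentPart hφ hN hV.smooth_field
  refine ⟨⟨fun h x X Y => ?_, fun h => ⟨hUs, hη, hlam, hmu, fun x X Y => ?_⟩⟩,
    ⟨fun h x X Y => ?_, fun h => ⟨hUs, hη, hlam, hmu, fun x X Y => ?_⟩⟩,
    fun _ => SphereSoliton.isPseudoQuasiUmbilical hφ hN⟩
  · have h' := h.equation x X Y
    rw [SphereSoliton.lieDeriv_eq hφ hN hV, SphereSoliton.Ric_eq hφ hN] at h'
    -- Once `g(U, ·)` is written as `⟨V, dφ ·⟩`, the two equations differ only by moving terms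
    -- across; the other three cases are alike.
    rw [SphereSoliton.inducedMetric_tangentPart hφ hN,
      SphereSoliton.inducedMetric_tangentPart hφ hN]
    linarith
  · have h' := h x X Y
    rw [SphereSoliton.inducedMetric_tangentPart hφ hN,
      SphereSoliton.inducedMetric_tangentPart hφ hN] at h'
    rw [SphereSoliton.lieDeriv_eq hφ hN hV, SphereSoliton.Ric_eq hφ hN]
    linarith
  · have h' := h.equation x X Y
    rw [SphereSoliton.lieDeriv_eq hφ hN hV, SphereSoliton.scal_eq hφ hN] at h'
    rw [SphereSoliton.inducedMetric_tangentPart hφ hN,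
      SphereSoliton.inducedMetric_tangentPart hφ hN]
    linarith
  · have h' := h x X Y
    rw [SphereSoliton.inducedMetric_tangentPart hφ hN,
      SphereSoliton.inducedMetric_tangentPart hφ hN] at h'
    rw [SphereSoliton.lieDeriv_eq hφ hN hV, SphereSoliton.scal_eq hφ hN]
    linarith
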